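/- Let $m>3$ and let $\mathrm{P}^3(m)=Q\times[0,1]$ be the prism over a convex $m$-gon $Q$, with ceiling $c=Q\times\{1\}$, floor $f=Q\times\{0\}$ and side faces $s_1,\dots,s_m$ in cyclic order (indices mod $m$). A $\mathbb{Z}_2^3$-coloring $\lambda$ on $\mathrm{P}^3(m)$ assigns to each facet $F$ a vector $\lambda(F)\in\mathbb{Z}_2^3$ such that the colors of any facets with nonempty common intersection are linearly independent; $\lambda$ is nontrivial if $\lambda(c)\neq\lambda(f)$. Its small cover is the quotient space $$M(\lambda)=\mathrm{P}^3(m)\times\mathbb{Z}_2^3/\sim,$$ where $\sim$ is the equivalence relation generated by $(p,v)\sim(p,v+\lambda(F))$ for $p\in F$, $F$ a facet. Let $m_\lambda$ be the number of side faces $s_i$ with $\mathrm{Span}\{\lambda(s_{i-1}),\lambda(s_i),\lambda(s_{i+1})\}=\mathbb{Z}_2^3$, and let $n_\lambda$ be the number of side faces $s_i$ with $\lambda(s_i)=\lambda(c)-\lambda(f)$. Let $\lambda_1,\lambda_2$ be two nontrivial colorings on $\mathrm{P}^3(m)$. If $(m_{\lambda_1},n_{\lambda_1})=(m_{\lambda_2},n_{\lambda_2})$,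 then $M(\lambda_1)$ and $M(\lambda_2)$ are homeomorphic. -/

import Mathlib

/-! ### Colorings of simple polytopes and their small covers -/

/-- Let `P` be a simple polytope in `E` with facets `F i`, `i : ι`. A `ℤ₂ⁿ`-coloring (characteristic
function) assigns to each facet a vector in `ℤ₂ⁿ` so that, whenever some facets have a common point,
their colors are linearly independent. -/
def IsColoring {E ι : Type*} {n : ℕ} (P : Set E) (F : ι → Set E)
    (lam : ι → (Fin n → ZMod 2)) : Prop :=
  ∀ t : Finset ι, (P ∩ ⋂ i ∈ t, F i).Nonempty →
    LinearIndependent (ZMod 2) (fun i : t => lam i)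

/-- The gluing `(p, v) ∼ (p, v + λ(F))` for `p ∈ F`, `F` a facet. -/
inductive SmallCoverRel {E ι : Type*} {n : ℕ} (P : Set E) (F : ι → Set E)
    (lam : ι → (Fin n → ZMod 2)) :
    P × (Fin n → ZMod 2) → P × (Fin n → ZMod 2) → Prop
  | glue (p : P) (v : Fin n → ZMod 2) (i : ι) (hp : (p : E) ∈ F i) :
      SmallCoverRel P F lam (p, v) (p, v + lam i)

/-- The small cover `M(λ) = P × ℤ₂ⁿ / ∼`, where `∼` is the equivalence relation generated by
`SmallCoverRel`. -/
def SmallCover {E ι : Type*} {n : ℕ} (P : Set E) (F : ι → Set E)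
    (lam : ι → (Fin n → ZMod 2)) : Type _ :=
  Quot (SmallCoverRel P F lam)

/-- The quotient topology of the product topology (`ℤ₂ⁿ` is discrete). -/
instance SmallCover.instTopologicalSpace {E ι : Type*} [TopologicalSpace E] {n : ℕ} (P : Set E)
    (F : ι → Set E) (lam : ι → (Fin n → ZMod 2)) : TopologicalSpace (SmallCover P F lam) :=
  inferInstanceAs (TopologicalSpace (Quot (SmallCoverRel P F lam)))

/-! ### The prism `P³(m)` -/

/-- The vertices `exp(2πik/m)` of the regular `m`-gon. -/
noncomputable def polygonVertex (m k : ℕ) : ℂ :=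
  Complex.exp (2 * Real.pi * Complex.I * (k / m))

/-- The regular `m`-gon. -/
noncomputable def polygon (m : ℕ) : Set ℂ :=
  convexHull ℝ (Set.range (polygonVertex m))

/-- The `i`-th edge of the regular `m`-gon; the indices are cyclic. -/
noncomputable def polygonEdge (m : ℕ) (i : ZMod m) : Set ℂ :=
  segment ℝ (polygonVertex m i.val) (polygonVertex m (i.val + 1))

/-- The prism `P³(m)`: the product of an `m`-gon and `[0,1]`. -/
noncomputable def prism (m : ℕ) : Set (ℂ × ℝ) :=
  polygon m ×ˢ Set.Icc (0 : ℝ) 1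

/-- Labels of the facets of `P³(m)`: ceiling, floor, and the cyclically indexed side faces. -/
inductive PrismFacet (m : ℕ) : Type
  | ceiling : PrismFacet m
  | floor : PrismFacet m
  | side (i : ZMod m) : PrismFacet m

/-- The facets of `P³(m)`. -/
noncomputable def prismFacet (m : ℕ) : PrismFacet m → Set (ℂ × ℝ)
  | .ceiling => polygon m ×ˢ {1}
  | .floor => polygon m ×ˢ {0}
  | .side i => polygonEdge m i ×ˢ Set.Icc (0 : ℝ) 1

/-- `λ` is a `ℤ₂³`-coloring on `P³(m)`. -/
def IsPrismColoring {m : ℕ} (lam : PrismFacet m → (Fin 3 → ZMod 2)) : Prop :=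
  IsColoring (prism m) (prismFacet m) lam

/-- The small cover `M(λ)` over `P³(m)`. -/
abbrev PrismSmallCover {m : ℕ} (lam : PrismFacet m → (Fin 3 → ZMod 2)) : Type :=
  SmallCover (prism m) (prismFacet m) lam

/-- `λ` is nontrivial: the ceiling and the floor have different colors. -/
def IsNontrivialColoring {m : ℕ} (lam : PrismFacet m → (Fin 3 → ZMod 2)) : Prop :=
  lam .ceiling ≠ lam .floor

/-- `m_λ`: the number of side faces `s_i` such that `λ(s_{i-1}), λ(s_i), λ(s_{i+1})` span `ℤ₂³`. -/
noncomputable def mInv {m : ℕ} (lam : PrismFacet m → (Fin 3 → ZMod 2)) : ℕ :=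
  {i : ZMod m | Submodule.span (ZMod 2)
    {lam (.side (i - 1)), lam (.side i), lam (.side (i + 1))} = ⊤}.ncard

/-- `n_λ`: the number of side faces `s_i` with `λ(s_i) = λ(c) - λ(f)`. -/
noncomputable def nInv {m : ℕ} (lam : PrismFacet m → (Fin 3 → ZMod 2)) : ℕ :=
  {i : ZMod m | lam (.side i) = lam .ceiling - lam .floor}.ncard

/-! After an automorphism of ℤ₂³, λ(c) = (1,0,0) and λ(f) = (1,1,0); put D = λ(c) - λ(f) = (0,1,0).
Independence at the vertices forces each side color to be D or a "gap color", one with third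
coordinate 1. No two D's are adjacent, and adjacent gap colors differ by D
(`colorAdj_of_isSideColor`). Going once around the prism from a gap color is thus a closed walk
through gap colors. Each letter leads to the next gap color, either directly, by the step D, or
across one face colored D, by any step with third coordinate 0. Here n_λ counts the letters that
cross a D, and m_λ counts the letters whose step has first coordinate 1 (`colorAdj_span_iff`).

Besides rotations of the prism, two moves change the coloring, both instances of `Shear`. The
polytope is sliced into parallel segments. In the small cover the copies of a segment are glued at
their ends into circles, and these are rotated by an amount that depends on the segment; a linear
form l separates the sheets moving up from those moving down. Where the rotation is by a full
segment length, facets are reflected, and a color a with l a = 1 becomes a + b₀ + b₁, where b₀ and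
b₁ are the colors at the two ends of the segments.

With vertical segments the ends are floor and ceiling, and gap colors change by D; hence second
coordinates of gap colors are irrelevant (`nonempty_homeomorph_of_eq_mod`). With segments joining
two gap-colored side faces, the colors between these are reversed, which can interchange two
consecutive letters (`nonempty_homeomorph_walk_swap`). Together with rotations this gives all
permutations of the letters (`nonempty_homeomorph_walk_perm`). Modulo D there are only three kinds
of letters, and m, m_λ, n_λ determine how many of each occur; so they determine the small cover
(`nonempty_homeomorph_walk`). -/

namespace SmallCover

/-! ### Homeomorphisms between small covers -/

variable {E ι : Type*} {n : ℕ} {P : Set E} {F : ι → Set E} {lam lam' : ι → (Fin n → ZMod 2)}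

/-- The point of the small cover represented by `(p, v)`. -/
def mk (P : Set E) (F : ι → Set E) (lam : ι → (Fin n → ZMod 2)) (p : P) (v : Fin n → ZMod 2) :
    SmallCover P F lam := Quot.mk _ (p, v)

theorem mk_add (p : P) (v : Fin n → ZMod 2) (i : ι) (hp : (p : E) ∈ F i) :
    mk P F lam p (v + lam i) = mk P F lam p v :=
  (Quot.sound (SmallCoverRel.glue p v i hp)).symm

theorem add_add_cancel_two (v w : Fin n → ZMod 2) : v + w + w = v := by
  rw [add_assoc]; ext j; simp [CharTwo.add_self_eq_zero]

variable [TopologicalSpace E]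

theorem continuous_mk (v : Fin n → ZMod 2) : Continuous fun p : P => mk P F lam p v :=
  continuous_quot_mk.comp (by fun_prop)

/-- Maps on `P × ℤ₂ⁿ` that are mutually inverse after passing to the small covers yield a
homeomorphism. -/
theorem nonempty_homeomorph_of_maps
    (f : P → (Fin n → ZMod 2) → SmallCover P F lam')
    (g : P → (Fin n → ZMod 2) → SmallCover P F lam)
    (hf : ∀ v, Continuous fun p => f p v) (hg : ∀ v, Continuous fun p => g p v)
    (hfr : ∀ (p : P) v i, (p : E) ∈ F i → f p v = f p (v + lam i))
    (hgr : ∀ (p : P) v i, (p : E) ∈ F i → g p v = g p (v + lam' i))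
    (hfg : ∀ p v, ∃ q w, f p v = mk P F lam' q w ∧ g q w = mk P F lam p v)
    (hgf : ∀ p v, ∃ q w, g p v = mk P F lam q w ∧ f q w = mk P F lam' p v) :
    Nonempty (SmallCover P F lam ≃ₜ SmallCover P F lam') := by
  let f' : SmallCover P F lam → SmallCover P F lam' :=
    Quot.lift (fun x => f x.1 x.2) (by rintro _ _ ⟨p, v, i, hp⟩; exact hfr p v i hp)
  let g' : SmallCover P F lam' → SmallCover P F lam :=
    Quot.lift (fun x => g x.1 x.2) (by rintro _ _ ⟨p, v, i, hp⟩; exact hgr p v i hp)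
  refine ⟨⟨⟨f', g', ?_, ?_⟩, ?_, ?_⟩⟩
  · rintro ⟨p, v⟩
    obtain ⟨q, w, h1, h2⟩ := hfg p v
    change g' (f p v) = _
    rw [h1]; exact h2
  · rintro ⟨p, v⟩
    obtain ⟨q, w, h1, h2⟩ := hgf p v
    change f' (g p v) = _
    rw [h1]; exact h2
  · exact continuous_quot_lift _ (continuous_prod_of_discrete_right.2 hf)
  · exact continuous_quot_lift _ (continuous_prod_of_discrete_right.2 hg)

/-- A symmetry of `P` permuting the facets, together with an automorphism of `ℤ₂ⁿ`, induces a
homeomorphism of small covers. -/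
theorem nonempty_homeomorph_of_symmetry (φ : E ≃ₜ E) (σ : ι ≃ ι)
    (A : (Fin n → ZMod 2) ≃ₗ[ZMod 2] (Fin n → ZMod 2))
    (hP : ∀ x, φ x ∈ P ↔ x ∈ P) (hF : ∀ i x, φ x ∈ F (σ i) ↔ x ∈ F i)
    (h : ∀ i, lam' (σ i) = A (lam i)) :
    Nonempty (SmallCover P F lam ≃ₜ SmallCover P F lam') := by
  have hP' : ∀ x, φ.symm x ∈ P ↔ x ∈ P := fun x => by rw [← hP, φ.apply_symm_apply]
  refine nonempty_homeomorph_of_maps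
    (fun p v => mk P F lam' ⟨φ p, (hP _).2 p.2⟩ (A v))
    (fun p v => mk P F lam ⟨φ.symm p, (hP' _).2 p.2⟩ (A.symm v))
    (fun v => (continuous_mk _).comp (by fun_prop))
    (fun v => (continuous_mk _).comp (by fun_prop)) ?_ ?_ ?_ ?_
  · intro p v i hp
    rw [map_add, ← h, mk_add _ _ _ (by exact (hF i _).2 hp)]
  · intro p v i hp
    obtain ⟨i, rfl⟩ := σ.surjective i
    rw [map_add, h, A.symm_apply_apply, mk_add]
    rw [← hF]; simpa using hp
  · intro p v
    exact ⟨_, _, rfl, by simp⟩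
  · intro p v
    exact ⟨_, _, rfl, by simp⟩

end SmallCover

/-! ### Twists: rotating the circles formed by copies of parallel segments -/

open SmallCover

/-- Data for rotating the part `α > 0` of a small cover along a direction `e`: lines in
direction `e` meet the region `|τ| ≤ W` in intervals, and are turned by the fraction `α` of a half
turn of the circle to which two copies of the interval are glued. -/
structure Shear {E : Type*} [AddCommGroup E] [Module ℝ E] [TopologicalSpace E] (P : Set E) where
  /-- the direction -/
  dir : E
  /-- the coordinate in this direction -/
  coord : E → ℝ
  /-- the half width of the interval -/
  width : E → ℝ
  /-- the amount of rotation -/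
  turn : E → ℝ
  continuous_coord : Continuous coord
  continuous_width : Continuous width
  continuous_turn : Continuous turn
  coord_add : ∀ (x : E) (s : ℝ), coord (x + s • dir) = coord x + s
  width_add : ∀ (x : E) (s : ℝ), width (x + s • dir) = width x
  turn_add : ∀ (x : E) (s : ℝ), turn (x + s • dir) = turn x
  turn_nonneg : ∀ x, 0 ≤ turn x
  turn_le_one : ∀ x, turn x ≤ 1
  abs_coord_le : ∀ x ∈ P, |coord x| ≤ width x
  -- The new coordinate is W - |W - (τ + 2Wα)|, that is, τ + 2Wα folded back at the wall τ = W.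
  mem_up : ∀ x ∈ P,
    x + (width x - |width x - coord x - 2 * width x * turn x| - coord x) • dir ∈ P
  mem_down : ∀ x ∈ P,
    x + (|width x + coord x - 2 * width x * turn x| - width x - coord x) • dir ∈ P

namespace Shear

variable {E ι : Type*} [AddCommGroup E] [Module ℝ E] [TopologicalSpace E] {P : Set E}

/-- The shear with reversed direction. -/
def neg (S : Shear P) : Shear P where
  dir := -S.dir
  coord x := -S.coord x
  width := S.width
  turn := S.turn
  continuous_coord := S.continuous_coord.neg
  continuous_width := S.continuous_width
  continuous_turn := S.continuous_turn
  coord_add x s := by rw [smul_neg, ← neg_smul, S.coord_add]; ring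
  width_add x s := by rw [smul_neg, ← neg_smul, S.width_add]
  turn_add x s := by rw [smul_neg, ← neg_smul, S.turn_add]
  turn_nonneg := S.turn_nonneg
  turn_le_one := S.turn_le_one
  abs_coord_le x hx := by rw [abs_neg]; exact S.abs_coord_le x hx
  mem_up x hx := by
    convert S.mem_down x hx using 2
    rw [smul_neg, ← neg_smul]
    ring_nf
  mem_down x hx := by
    convert S.mem_up x hx using 2
    rw [smul_neg, ← neg_smul]
    ring_nf

/-- The image of a point when rotating upwards. -/
def up (S : Shear P) (x : E) : E :=
  x + (S.width x - |S.width x - S.coord x - 2 * S.width x * S.turn x| - S.coord x) • S.dir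

theorem neg_neg (S : Shear P) : S.neg.neg = S := by
  simp [neg]

variable (S : Shear P)

theorem width_nonneg {x : E} (hx : x ∈ P) : 0 ≤ S.width x :=
  (abs_nonneg _).trans (S.abs_coord_le x hx)

theorem up_eq_of_le {x : E} (h : S.coord x + 2 * S.width x * S.turn x ≤ S.width x) :
    S.up x = x + (2 * S.width x * S.turn x) • S.dir := by
  rw [up, abs_of_nonneg (by linarith)]
  congr 2; ring

theorem up_eq_of_ge {x : E} (h : S.width x ≤ S.coord x + 2 * S.width x * S.turn x) :
    S.up x = x + (2 * S.width x - 2 * S.coord x - 2 * S.width x * S.turn x) • S.dir := by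
  rw [up, abs_of_nonpos (by linarith)]
  congr 2; ring

theorem up_eq_self {x : E} (hx : x ∈ P) (h : S.turn x = 0) : S.up x = x := by
  have := abs_le.1 (S.abs_coord_le x hx)
  rw [up_eq_of_le _ (by rw [h]; linarith), h]; simp

theorem up_eq_reflect {x : E} (hx : x ∈ P) (h : S.turn x = 1) :
    S.up x = x - (2 * S.coord x) • S.dir := by
  have := abs_le.1 (S.abs_coord_le x hx)
  rw [up_eq_of_ge _ (by rw [h]; linarith), h, sub_eq_add_neg x, ← neg_smul]
  congr 2; ring

theorem neg_up_eq_reflect {x : E} (hx : x ∈ P) (h : S.turn x = 1) :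
    S.neg.up x = x - (2 * S.coord x) • S.dir := by
  rw [S.neg.up_eq_reflect hx h]; simp [neg]

theorem up_mem {x : E} (hx : x ∈ P) : S.up x ∈ P := S.mem_up x hx

theorem continuous_up [ContinuousAdd E] [ContinuousSMul ℝ E] : Continuous S.up := by
  have h1 := S.continuous_coord
  have h2 := S.continuous_width
  have h3 := S.continuous_turn
  unfold up
  fun_prop

theorem turn_up (x : E) : S.turn (S.up x) = S.turn x := S.turn_add _ _

theorem width_up (x : E) : S.width (S.up x) = S.width x := S.width_add _ _

theorem coord_up_of_le {x : E} (h : S.coord x + 2 * S.width x * S.turn x ≤ S.width x) :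
    S.coord (S.up x) = S.coord x + 2 * S.width x * S.turn x := by
  rw [S.up_eq_of_le h, S.coord_add]

theorem coord_up_of_ge {x : E} (h : S.width x ≤ S.coord x + 2 * S.width x * S.turn x) :
    S.coord (S.up x) = 2 * S.width x - S.coord x - 2 * S.width x * S.turn x := by
  rw [S.up_eq_of_ge h, S.coord_add]; ring

theorem neg_coord (x : E) : S.neg.coord x = -S.coord x := rfl

theorem neg_width (x : E) : S.neg.width x = S.width x := rfl

theorem neg_turn (x : E) : S.neg.turn x = S.turn x := rfl

/-- Before the wall is passed no folding occurs, so moving down by the same amount undoes the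
motion. -/
theorem neg_up_up {x : E} (hx : x ∈ P)
    (h : S.coord x + 2 * S.width x * S.turn x ≤ S.width x) : S.neg.up (S.up x) = x := by
  have := abs_le.1 (S.abs_coord_le x hx)
  rw [S.neg.up_eq_of_le, neg_width, neg_turn, turn_up, width_up, S.up_eq_of_le h]
  · simp [neg]
  · rw [neg_width, neg_turn, turn_up, width_up, neg_coord, coord_up_of_le _ h]
    linarith

/-- A point that has passed the wall lies on the neighboring sheet, where the circle runs through
the segment backwards; the reverse rotation is therefore again upwards. -/
theorem up_up {x : E} (hx : x ∈ P)
    (h : S.width x ≤ S.coord x + 2 * S.width x * S.turn x) : S.up (S.up x) = x := by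
  have := abs_le.1 (S.abs_coord_le x hx)
  rw [S.up_eq_of_ge, turn_up, width_up, coord_up_of_ge _ h]
  · nth_rw 1 [S.up_eq_of_ge h]
    rw [add_assoc, ← add_smul]
    convert add_zero x
    convert zero_smul ℝ S.dir
    ring
  · rw [turn_up, width_up, coord_up_of_ge _ h]
    linarith

variable {n : ℕ} (F : ι → Set E) (lam : ι → (Fin n → ZMod 2))

/-- The wall at `τ = W` is covered by facets of color `b`. -/
def HasWall (b : Fin n → ZMod 2) : Prop :=
  ∀ x ∈ P, S.coord x + 2 * S.width x * S.turn x = S.width x → ∃ j, S.up x ∈ F j ∧ lam j = b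

/-- Rotating upwards, one crosses the wall of color `b` after passing `τ = W`. -/
noncomputable def half (b : Fin n → ZMod 2) (x : P) (v : Fin n → ZMod 2) : SmallCover P F lam :=
  if S.coord x + 2 * S.width x * S.turn x ≤ S.width x then
    SmallCover.mk P F lam ⟨S.up x, S.up_mem x.2⟩ v
  else SmallCover.mk P F lam ⟨S.up x, S.up_mem x.2⟩ (v + b)

variable {F lam S}

theorem half_eq_of_le {b : Fin n → ZMod 2} {x : P} (v : Fin n → ZMod 2)
    (h : S.coord x + 2 * S.width x * S.turn x ≤ S.width x) :
    S.half F lam b x v = SmallCover.mk P F lam ⟨S.up x, S.up_mem x.2⟩ v := if_pos h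

theorem HasWall.mk_up_add {b : Fin n → ZMod 2} (hb : S.HasWall F lam b) {x : P}
    (v : Fin n → ZMod 2) (h : S.coord x + 2 * S.width x * S.turn x = S.width x) :
    SmallCover.mk P F lam ⟨S.up x, S.up_mem x.2⟩ (v + b) =
      SmallCover.mk P F lam ⟨S.up x, S.up_mem x.2⟩ v := by
  obtain ⟨j, hj, rfl⟩ := hb x x.2 h
  exact SmallCover.mk_add _ _ _ hj

theorem HasWall.half_eq_of_ge {b : Fin n → ZMod 2} (hb : S.HasWall F lam b) {x : P}
    (v : Fin n → ZMod 2) (h : S.width x ≤ S.coord x + 2 * S.width x * S.turn x) :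
    S.half F lam b x v = SmallCover.mk P F lam ⟨S.up x, S.up_mem x.2⟩ (v + b) := by
  rcases h.eq_or_lt with h | h
  · rw [half_eq_of_le v h.ge, hb.mk_up_add v h.symm]
  · exact if_neg (not_le.2 h)

theorem HasWall.continuous_half [ContinuousAdd E] [ContinuousSMul ℝ E] {b : Fin n → ZMod 2}
    (hb : S.HasWall F lam b) (v : Fin n → ZMod 2) :
    Continuous fun x => S.half F lam b x v := by
  have h1 := S.continuous_coord
  have h2 := S.continuous_width
  have h3 := S.continuous_turn
  have hup : Continuous fun x : P => (⟨S.up x, S.up_mem x.2⟩ : P) :=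
    (S.continuous_up.comp continuous_subtype_val).subtype_mk _
  exact Continuous.if_le ((SmallCover.continuous_mk v).comp hup)
    ((SmallCover.continuous_mk (v + b)).comp hup) (by fun_prop) (by fun_prop)
    fun x hx => (hb.mk_up_add v hx).symm

variable (S F)

/-- The condition under which the twist is compatible with gluing along a facet of color `a` at the
point `x`. -/
def CompatAt (lam : ι → (Fin n → ZMod 2)) (l : (Fin n → ZMod 2) →+ ZMod 2)
    (b₀ b₁ a : Fin n → ZMod 2) (x : E) : Prop :=
  (a = b₁ ∧ S.coord x = S.width x) ∨ (a = b₀ ∧ S.coord x = -S.width x) ∨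
  (l a = 0 ∧ (∃ j, S.up x ∈ F j ∧ lam j = a) ∧ ∃ j, S.neg.up x ∈ F j ∧ lam j = a) ∨
  (l a = 1 ∧ S.turn x = 0 ∧ ∃ j, x ∈ F j ∧ lam j = a) ∨
  (l a = 1 ∧ S.turn x = 1 ∧ ∃ j, x - (2 * S.coord x) • S.dir ∈ F j ∧ lam j = a + b₀ + b₁)

/-- The twist on the sheets `o v = 0` upwards, on the sheets `o v ≠ 0` downwards. -/
noncomputable def twist (lam : ι → (Fin n → ZMod 2)) (l : (Fin n → ZMod 2) →+ ZMod 2) (t : ZMod 2)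
    (b₀ b₁ : Fin n → ZMod 2) (x : P) (v : Fin n → ZMod 2) : SmallCover P F lam :=
  if l v = t then S.half F lam b₁ x v else S.neg.half F lam b₀ x v

variable {S F} {l : (Fin n → ZMod 2) →+ ZMod 2} {b₀ b₁ : Fin n → ZMod 2}

theorem eq_add_one_of_ne {a b : ZMod 2} (h : a ≠ b) : a = b + 1 := by
  revert a b; decide

/-- The cases follow `CompatAt`. At τ = W, moving up from v passes the wall and agrees with moving
down on v + b₁; τ = -W is symmetric. If l a = 0, both sheets move alike and the image stays on a
facet of color a. With turn 0 nothing moves. With turn 1 both points are reflected and the sheets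
gain b₁ and b₀ respectively, so the images differ by a + b₀ + b₁. -/
theorem twist_glue_aux (h0 : S.neg.HasWall F lam b₀) (h1 : S.HasWall F lam b₁)
    (hl1 : l b₁ = 1) (hl0 : l b₀ = 1) {t : ZMod 2} {a : Fin n → ZMod 2} {x : P}
    (hx : S.CompatAt F lam l b₀ b₁ a x) {v : Fin n → ZMod 2} (hv : l v = t) :
    S.twist F lam l t b₀ b₁ x v = S.twist F lam l t b₀ b₁ x (v + a) := by
  have hc := abs_le.1 (S.abs_coord_le x x.2)
  have hW := S.width_nonneg x.2
  have hWt := mul_nonneg hW (S.turn_nonneg x)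
  have hWt1 := mul_le_mul_of_nonneg_left (S.turn_le_one x) hW
  have e1 : S.twist F lam l t b₀ b₁ x v = S.half F lam b₁ x v := if_pos hv
  have e2 : l a = 1 → S.twist F lam l t b₀ b₁ x (v + a) = S.neg.half F lam b₀ x (v + a) := by
    intro ha
    refine if_neg ?_
    rw [map_add, hv, ha]; simp
  rw [e1]
  rcases hx with ⟨rfl, hx⟩ | ⟨rfl, hx⟩ | ⟨ha, ⟨j, hj, rfl⟩, -⟩ | ⟨ha, ht, j, hj, rfl⟩ |
    ⟨ha, ht, j, hj, hja⟩
  · have hle : S.width x ≤ S.coord x + 2 * S.width x * S.turn x := by rw [hx]; linarith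
    have hle' : S.neg.coord x + 2 * S.neg.width x * S.neg.turn x ≤ S.neg.width x := by
      rw [neg_coord, neg_width, neg_turn, hx]; linarith
    rw [e2 hl1, h1.half_eq_of_ge v hle, half_eq_of_le _ hle']
    congr 2
    rw [S.up_eq_of_ge hle, S.neg.up_eq_of_le hle', neg_width, neg_turn, hx]
    simp only [neg, smul_neg, ← neg_smul]
    congr 2; ring
  · have hle : S.coord x + 2 * S.width x * S.turn x ≤ S.width x := by rw [hx]; linarith
    have hle' : S.neg.width x ≤ S.neg.coord x + 2 * S.neg.width x * S.neg.turn x := by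
      rw [neg_coord, neg_width, neg_turn, hx]; linarith
    rw [e2 hl0, half_eq_of_le _ hle, h0.half_eq_of_ge _ hle', SmallCover.add_add_cancel_two]
    congr 2
    rw [S.up_eq_of_le hle, S.neg.up_eq_of_ge hle', neg_width, neg_turn, neg_coord, hx]
    simp only [neg, smul_neg, ← neg_smul]
    congr 2; ring
  · have e3 : S.twist F lam l t b₀ b₁ x (v + lam j) = S.half F lam b₁ x (v + lam j) :=
      if_pos (by rw [map_add, ha, hv, add_zero])
    rw [e3]
    rcases le_total (S.coord x + 2 * S.width x * S.turn x) (S.width x) with h | h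
    · rw [half_eq_of_le _ h, half_eq_of_le _ h, SmallCover.mk_add _ _ _ hj]
    · rw [h1.half_eq_of_ge _ h, h1.half_eq_of_ge _ h, add_right_comm, SmallCover.mk_add _ _ _ hj]
  · have hle : S.coord x + 2 * S.width x * S.turn x ≤ S.width x := by rw [ht]; linarith
    have hle' : S.neg.coord x + 2 * S.neg.width x * S.neg.turn x ≤ S.neg.width x := by
      rw [neg_coord, neg_width, neg_turn, ht]; linarith
    rw [e2 ha, half_eq_of_le _ hle, half_eq_of_le _ hle']
    have u1 := S.up_eq_self x.2 ht
    have u2 := S.neg.up_eq_self x.2 ht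
    simp only [u1, u2]
    rw [SmallCover.mk_add _ _ _ hj]
  · have hle : S.width x ≤ S.coord x + 2 * S.width x * S.turn x := by rw [ht]; linarith
    have hle' : S.neg.width x ≤ S.neg.coord x + 2 * S.neg.width x * S.neg.turn x := by
      rw [neg_coord, neg_width, neg_turn, ht]; linarith
    rw [e2 ha, h1.half_eq_of_ge _ hle, h0.half_eq_of_ge _ hle']
    have u1 := S.up_eq_reflect x.2 ht
    have u2 := S.neg_up_eq_reflect x.2 ht
    have hv' : v + a + b₀ = v + b₁ + lam j := by
      rw [hja, ← SmallCover.add_add_cancel_two (v + a + b₀) b₁]; abel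
    rw [hv', SmallCover.mk_add _ _ _ (u2.symm ▸ hj : S.neg.up x ∈ F j)]
    simp only [u1, u2]

/-- Gluing is symmetric in v and v + a, so the only remaining case is that both sheets move down,
which forces l a = 0. -/
theorem twist_glue (h0 : S.neg.HasWall F lam b₀) (h1 : S.HasWall F lam b₁)
    (hl1 : l b₁ = 1) (hl0 : l b₀ = 1) (t : ZMod 2) {a : Fin n → ZMod 2} {x : P}
    (hx : S.CompatAt F lam l b₀ b₁ a x) (v : Fin n → ZMod 2) :
    S.twist F lam l t b₀ b₁ x v = S.twist F lam l t b₀ b₁ x (v + a) := by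
  by_cases hv : l v = t
  · exact twist_glue_aux h0 h1 hl1 hl0 hx hv
  by_cases hva : l (v + a) = t
  · have := twist_glue_aux h0 h1 hl1 hl0 hx hva
    rwa [SmallCover.add_add_cancel_two, eq_comm] at this
  have ha : l a = 0 := by
    have h2 := eq_add_one_of_ne hv
    have h3 := eq_add_one_of_ne hva
    rw [map_add, h2] at h3
    simpa using h3
  have e1 : S.twist F lam l t b₀ b₁ x v = S.neg.half F lam b₀ x v := if_neg hv
  have e2 : S.twist F lam l t b₀ b₁ x (v + a) = S.neg.half F lam b₀ x (v + a) := if_neg hva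
  rw [e1, e2]
  have key : ∃ j, S.neg.up x ∈ F j ∧ lam j = a := by
    rcases hx with ⟨rfl, hx⟩ | ⟨rfl, hx⟩ | ⟨-, -, h⟩ | ⟨h, -⟩ | ⟨h, -⟩
    · simp [hl1] at ha
    · simp [hl0] at ha
    · exact h
    · simp [h] at ha
    · simp [h] at ha
  obtain ⟨j, hj, rfl⟩ := key
  rcases le_total (S.neg.coord x + 2 * S.neg.width x * S.neg.turn x) (S.neg.width x) with h | h
  · rw [half_eq_of_le _ h, half_eq_of_le _ h, SmallCover.mk_add _ _ _ hj]
  · rw [h0.half_eq_of_ge _ h, h0.half_eq_of_ge _ h, add_right_comm, SmallCover.mk_add _ _ _ hj]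

/-- The two outcomes are "wall not passed", undone by moving down on the same sheet, and "wall
passed", undone by moving up on the sheet v + b₁. -/
theorem half_twist {lam' : ι → (Fin n → ZMod 2)}
    (h1 : S.HasWall F lam b₁) (h1' : S.HasWall F lam' b₁)
    (x : P) (v : Fin n → ZMod 2) :
    ∃ q w, S.half F lam' b₁ x v = SmallCover.mk P F lam' q w ∧
      ((w = v ∧ S.neg.half F lam b₀ q w = SmallCover.mk P F lam x v) ∨
       (w = v + b₁ ∧ S.half F lam b₁ q w = SmallCover.mk P F lam x v)) := by
  have hc := abs_le.1 (S.abs_coord_le x x.2)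
  rcases le_total (S.coord x + 2 * S.width x * S.turn x) (S.width x) with h | h
  · refine ⟨_, _, half_eq_of_le _ h, Or.inl ⟨rfl, ?_⟩⟩
    rw [half_eq_of_le]
    · have := S.neg_up_up x.2 h
      simp only [this]
    · simp only [neg_width, neg_turn, neg_coord, turn_up, width_up, coord_up_of_le _ h]
      linarith
  · refine ⟨_, _, h1'.half_eq_of_ge _ h, Or.inr ⟨rfl, ?_⟩⟩
    rw [h1.half_eq_of_ge]
    · have := S.up_up x.2 h
      simp only [this, SmallCover.add_add_cancel_two]
    · simp only [turn_up, width_up, coord_up_of_ge _ h]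
      linarith

/-- Replacing t by t + 1 exchanges the sheets moving up and down and so reverses the rotation. As l
b₀ = l b₁ = 1, crossing a wall switches the class of the sheet, as `half_twist` requires. -/
theorem twist_twist {lam' : ι → (Fin n → ZMod 2)}
    (h0 : S.neg.HasWall F lam b₀) (h1 : S.HasWall F lam b₁)
    (h0' : S.neg.HasWall F lam' b₀) (h1' : S.HasWall F lam' b₁)
    (hl1 : l b₁ = 1) (hl0 : l b₀ = 1) (t : ZMod 2) (x : P) (v : Fin n → ZMod 2) :
    ∃ q w, S.twist F lam' l t b₀ b₁ x v = SmallCover.mk P F lam' q w ∧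
      S.twist F lam l (t + 1) b₀ b₁ q w = SmallCover.mk P F lam x v := by
  by_cases hv : l v = t
  · obtain ⟨q, w, e, h⟩ := half_twist (b₀ := b₀) h1 h1' x v
    refine ⟨q, w, (if_pos hv).trans e, ?_⟩
    rcases h with ⟨rfl, h⟩ | ⟨rfl, h⟩
    · refine (if_neg ?_).trans h
      rw [hv]; simp
    · refine (if_pos ?_).trans h
      rw [map_add, hv, hl1]
  · have hnn := S.neg_neg
    obtain ⟨q, w, e, h⟩ := half_twist (S := S.neg) (b₀ := b₁) h0 h0' x v
    refine ⟨q, w, (if_neg hv).trans e, ?_⟩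
    have hv' := eq_add_one_of_ne hv
    rw [hnn] at h
    rcases h with ⟨rfl, h⟩ | ⟨rfl, h⟩
    · exact (if_pos hv').trans h
    · refine (if_neg ?_).trans h
      rw [map_add, hv', hl0]; simp

theorem nonempty_homeomorph [ContinuousAdd E] [ContinuousSMul ℝ E] (S : Shear P)
    {lam lam' : ι → (Fin n → ZMod 2)} (l : (Fin n → ZMod 2) →+ ZMod 2) (b₀ b₁ : Fin n → ZMod 2)
    (hl0 : l b₀ = 1) (hl1 : l b₁ = 1)
    (h0 : S.neg.HasWall F lam b₀) (h1 : S.HasWall F lam b₁)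
    (h0' : S.neg.HasWall F lam' b₀) (h1' : S.HasWall F lam' b₁)
    (hc : ∀ i, ∀ x ∈ P, x ∈ F i → S.CompatAt F lam' l b₀ b₁ (lam i) x)
    (hc' : ∀ i, ∀ x ∈ P, x ∈ F i → S.CompatAt F lam l b₀ b₁ (lam' i) x) :
    Nonempty (SmallCover P F lam ≃ₜ SmallCover P F lam') := by
  refine SmallCover.nonempty_homeomorph_of_maps (S.twist F lam' l 0 b₀ b₁)
    (S.twist F lam l 1 b₀ b₁) ?_ ?_ ?_ ?_ ?_ ?_
  · intro v
    by_cases hv : l v = 0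
    · simpa only [twist, hv, if_true] using h1'.continuous_half v
    · simpa only [twist, hv, if_false] using h0'.continuous_half v
  · intro v
    by_cases hv : l v = 1
    · simpa only [twist, hv, if_true] using h1.continuous_half v
    · simpa only [twist, hv, if_false] using h0.continuous_half v
  · exact fun p v i hp => twist_glue h0' h1' hl1 hl0 0 (hc i p p.2 hp) v
  · exact fun p v i hp => twist_glue h0 h1 hl1 hl0 1 (hc' i p p.2 hp) v
  · exact fun p v => twist_twist h0 h1 h0' h1' hl1 hl0 0 p v
  · exact fun p v => twist_twist h0' h1' h0 h1 hl1 hl0 1 p v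

end Shear

/-! ### Geometry of the regular polygon -/

/-- The point `exp(2πit/m)` of the unit circle. -/
noncomputable def circlePoint (m : ℕ) (t : ℝ) : ℂ :=
  ⟨Real.cos (2 * Real.pi * t / m), Real.sin (2 * Real.pi * t / m)⟩

theorem polygonVertex_eq (m k : ℕ) : polygonVertex m k = circlePoint m k := by
  have : (2 * Real.pi * Complex.I * (k / m) : ℂ) =
      ((2 * Real.pi * (k : ℝ) / m : ℝ) : ℂ) * Complex.I := by
    push_cast; ring
  rw [polygonVertex, this]
  apply Complex.ext
  · rw [Complex.exp_ofReal_mul_I_re]; rfl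
  · rw [Complex.exp_ofReal_mul_I_im]; rfl

theorem circlePoint_add_int_mul {m : ℕ} (hm : 0 < m) (t : ℝ) (z : ℤ) :
    circlePoint m (t + z * m) = circlePoint m t := by
  have hm' : (m : ℝ) ≠ 0 := by positivity
  have : 2 * Real.pi * (t + z * m) / m = 2 * Real.pi * t / m + z * (2 * Real.pi) := by
    field_simp
  rw [circlePoint, this, Real.cos_add_int_mul_two_pi, Real.sin_add_int_mul_two_pi]
  rfl

theorem circlePoint_eq_of_intCast_eq {m : ℕ} (hm : 0 < m) {a b : ℤ}
    (h : (a : ZMod m) = b) : circlePoint m a = circlePoint m b := by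
  obtain ⟨z, hz⟩ := (ZMod.intCast_eq_intCast_iff_dvd_sub a b m).1 h
  have : (b : ℝ) = a + z * m := by
    have : b = a + z * m := by linarith
    exact_mod_cast this
  rw [this, circlePoint_add_int_mul hm]

theorem circlePoint_mem_range {m : ℕ} (hm : 0 < m) (a : ℤ) :
    circlePoint m a ∈ Set.range (polygonVertex m) := by
  refine ⟨(a % m).toNat, ?_⟩
  have h0 := Int.emod_nonneg a (by omega : (m : ℤ) ≠ 0)
  have : (((a % m).toNat : ℤ) : ZMod m) = a := by
    rw [Int.toNat_of_nonneg h0, ZMod.intCast_mod]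
  rw [polygonVertex_eq, ← circlePoint_eq_of_intCast_eq hm this]
  norm_cast

/-- The side of the regular polygon between the vertices with indices `a` and `a + 1`. -/
noncomputable def polygonSide (m : ℕ) (a : ℤ) : Set ℂ :=
  segment ℝ (circlePoint m a) (circlePoint m (a + 1 : ℤ))

theorem polygonSide_eq_of_intCast_eq {m : ℕ} (hm : 0 < m) {a b : ℤ} (h : (a : ZMod m) = b) :
    polygonSide m a = polygonSide m b := by
  have h' : ((a + 1 : ℤ) : ZMod m) = (b + 1 : ℤ) := by push_cast; rw [h]
  rw [polygonSide, polygonSide, circlePoint_eq_of_intCast_eq hm h,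
    circlePoint_eq_of_intCast_eq hm h']

theorem polygonEdge_eq_val (m : ℕ) (i : ZMod m) : polygonEdge m i = polygonSide m i.val := by
  rw [polygonEdge, polygonSide, polygonVertex_eq, polygonVertex_eq]
  push_cast; rfl

theorem polygonEdge_intCast {m : ℕ} (hm : 0 < m) (a : ℤ) :
    polygonEdge m (a : ZMod m) = polygonSide m a := by
  have : NeZero m := ⟨hm.ne'⟩
  rw [polygonEdge_eq_val]
  apply polygonSide_eq_of_intCast_eq hm
  simp

theorem convex_polygon (m : ℕ) : Convex ℝ (polygon m) := convex_convexHull ℝ _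

theorem circlePoint_mem_polygon {m : ℕ} (hm : 0 < m) (a : ℤ) : circlePoint m a ∈ polygon m :=
  subset_convexHull ℝ _ (circlePoint_mem_range hm a)

theorem polygonSide_subset {m : ℕ} (hm : 0 < m) (a : ℤ) : polygonSide m a ⊆ polygon m :=
  (convex_polygon m).segment_subset (circlePoint_mem_polygon hm a) (circlePoint_mem_polygon hm _)

/-- The coordinate in the direction of angle `θ`. -/
noncomputable def axisCoord (θ : ℝ) : ℂ →ₗ[ℝ] ℝ :=
  Real.cos θ • Complex.reLm + Real.sin θ • Complex.imLm

/-- The coordinate orthogonal to the direction of angle `θ`. -/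
noncomputable def orthCoord (θ : ℝ) : ℂ →ₗ[ℝ] ℝ :=
  Real.cos θ • Complex.imLm - Real.sin θ • Complex.reLm

theorem axisCoord_apply (θ : ℝ) (q : ℂ) :
    axisCoord θ q = Real.cos θ * q.re + Real.sin θ * q.im := rfl

theorem orthCoord_apply (θ : ℝ) (q : ℂ) :
    orthCoord θ q = Real.cos θ * q.im - Real.sin θ * q.re := rfl

theorem axisCoord_add (θ δ : ℝ) (q : ℂ) :
    axisCoord (θ + δ) q = Real.cos δ * axisCoord θ q + Real.sin δ * orthCoord θ q := by
  simp only [axisCoord_apply, orthCoord_apply, Real.cos_add, Real.sin_add]; ring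

theorem axisCoord_sub (θ δ : ℝ) (q : ℂ) :
    axisCoord (θ - δ) q = Real.cos δ * axisCoord θ q - Real.sin δ * orthCoord θ q := by
  simp only [axisCoord_apply, orthCoord_apply, Real.cos_sub, Real.sin_sub]; ring

theorem axisCoord_circlePoint (θ : ℝ) (m : ℕ) (t : ℝ) :
    axisCoord θ (circlePoint m t) = Real.cos (2 * Real.pi * t / m - θ) := by
  rw [axisCoord_apply, Real.cos_sub, circlePoint]; ring

theorem orthCoord_circlePoint (θ : ℝ) (m : ℕ) (t : ℝ) :
    orthCoord θ (circlePoint m t) = Real.sin (2 * Real.pi * t / m - θ) := by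
  rw [orthCoord_apply, Real.sin_sub, circlePoint]; ring

theorem ext_coord {θ : ℝ} {p q : ℂ} (h1 : axisCoord θ p = axisCoord θ q)
    (h2 : orthCoord θ p = orthCoord θ q) : p = q := by
  have h := Real.sin_sq_add_cos_sq θ
  simp only [axisCoord_apply, orthCoord_apply] at h1 h2
  apply Complex.ext
  · linear_combination Real.cos θ * h1 - Real.sin θ * h2 - (p.re - q.re) * h
  · linear_combination Real.sin θ * h1 + Real.cos θ * h2 - (p.im - q.im) * h

/-- Cosine decreases on [0, π] and is symmetric about π, so an x beyond m / 2 may be replaced by m -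
x. -/
theorem cos_lt_cos_of_mem_Ioo {m : ℝ} (hm : 0 < m) {x y : ℝ} (hy : 0 ≤ y) (h1 : y < x)
    (h2 : x < m - y) : Real.cos (2 * Real.pi * x / m) < Real.cos (2 * Real.pi * y / m) := by
  have hp := Real.pi_pos
  have key : ∀ x, y < x → 2 * x ≤ m →
      Real.cos (2 * Real.pi * x / m) < Real.cos (2 * Real.pi * y / m) := by
    intro x h1 h2
    apply Real.cos_lt_cos_of_nonneg_of_le_pi
    · positivity
    · rw [div_le_iff₀ hm]; nlinarith
    · gcongr
  rcases le_total (2 * x) m with h | h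
  · exact key x h1 h
  · have := key (m - x) (by linarith) (by linarith)
    rwa [show 2 * Real.pi * (m - x) / m = 2 * Real.pi - 2 * Real.pi * x / m by field_simp,
      Real.cos_two_pi_sub] at this

theorem cos_le_cos_of_mem_Icc {m : ℝ} (hm : 0 < m) {x y : ℝ} (hy : 0 ≤ y) (h1 : y ≤ x)
    (h2 : x ≤ m - y) : Real.cos (2 * Real.pi * x / m) ≤ Real.cos (2 * Real.pi * y / m) := by
  rcases h1.eq_or_lt with rfl | h1
  · rfl
  rcases h2.eq_or_lt with rfl | h2
  · rw [show 2 * Real.pi * (m - y) / m = 2 * Real.pi - 2 * Real.pi * y / m by field_simp,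
      Real.cos_two_pi_sub]
  · exact (cos_lt_cos_of_mem_Ioo hm hy h1 h2).le

/-- The angle of the outer normal of a side. -/
noncomputable def normalAngle (m : ℕ) (a : ℤ) : ℝ := Real.pi * (2 * a + 1) / m

theorem axisCoord_normalAngle_circlePoint (m : ℕ) (a b : ℤ) :
    axisCoord (normalAngle m a) (circlePoint m b) =
      Real.cos (2 * Real.pi * ((b - a : ℤ) - 1 / 2) / m) := by
  rw [axisCoord_circlePoint, normalAngle]
  congr 1; push_cast; ring

theorem axisCoord_normalAngle_left (m : ℕ) (a : ℤ) :
    axisCoord (normalAngle m a) (circlePoint m a) = Real.cos (Real.pi / m) := by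
  rw [axisCoord_normalAngle_circlePoint, ← Real.cos_neg]
  congr 1; push_cast; ring

theorem axisCoord_normalAngle_right (m : ℕ) (a : ℤ) :
    axisCoord (normalAngle m a) (circlePoint m (a + 1 : ℤ)) = Real.cos (Real.pi / m) := by
  rw [axisCoord_normalAngle_circlePoint]
  congr 1; push_cast; ring

/-- Counted in steps of 2π/m from the normal, the ends of side a are at distance 1/2, while vertex b
is at b - a - 1/2, between 3/2 and m - 3/2. -/
theorem axisCoord_normalAngle_lt {m : ℕ} {a b : ℤ} (h1 : a + 2 ≤ b) (h2 : b < a + m) :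
    axisCoord (normalAngle m a) (circlePoint m b) < Real.cos (Real.pi / m) := by
  have hm : (0 : ℝ) < m := by
    have : 0 < (m : ℤ) := by linarith
    exact_mod_cast this
  have h1' : (2 : ℝ) ≤ (b - a : ℤ) := by
    have : 2 ≤ b - a := by linarith
    exact_mod_cast this
  have h2' : ((b - a : ℤ) : ℝ) ≤ m - 1 := by
    have : b - a ≤ m - 1 := by linarith
    exact_mod_cast this
  rw [axisCoord_normalAngle_circlePoint,
    show Real.pi / m = 2 * Real.pi * (1 / 2) / m by ring]
  apply cos_lt_cos_of_mem_Ioo hm <;> linarith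

/-- A side is the face of the polygon in the direction of its normal. -/
theorem polygon_subset_halfSpace {m : ℕ} (hm : 0 < m) (a : ℤ) {q : ℂ} (hq : q ∈ polygon m) :
    axisCoord (normalAngle m a) q < Real.cos (Real.pi / m) ∨ q ∈ polygonSide m a := by
  set f := axisCoord (normalAngle m a)
  set C := Real.cos (Real.pi / m)
  have hside : ∀ q ∈ polygonSide m a, f q = C := by
    rintro q ⟨s, t, hs, ht, hst, rfl⟩
    rw [map_add, map_smul, map_smul, axisCoord_normalAngle_left, axisCoord_normalAngle_right,
      ← add_smul, hst, one_smul]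
  -- An open half-plane together with a convex part of its boundary line is convex; so only the
  -- vertices of the polygon have to be checked.
  have hconv : Convex ℝ {q | f q < C ∨ q ∈ polygonSide m a} := by
    rw [convex_iff_forall_pos]
    intro x hx y hy s t hs ht hst
    have hle : ∀ z, (f z < C ∨ z ∈ polygonSide m a) → f z ≤ C := fun z hz =>
      hz.elim le_of_lt fun h => (hside z h).le
    have e : f (s • x + t • y) = s * f x + t * f y := by
      rw [map_add, map_smul, map_smul, smul_eq_mul, smul_eq_mul]
    have eC : C = s * C + t * C := by rw [← add_mul, hst, one_mul]
    rcases hx with hx | hx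
    · left
      rw [e, eC]
      nlinarith [hle y hy]
    rcases hy with hy | hy
    · left
      rw [e, eC]
      nlinarith [hle x (Or.inr hx)]
    · exact Or.inr (convex_segment _ _ hx hy hs.le ht.le hst)
  refine convexHull_min ?_ hconv hq
  rintro _ ⟨k, rfl⟩
  rw [polygonVertex_eq]
  -- The representative of k modulo m in the window from a to a + m - 1.
  set b : ℤ := a + (k - a) % m
  have hmz : (m : ℤ) ≠ 0 := by omega
  have hb0 := Int.emod_nonneg (k - a) hmz
  have hb1 := Int.emod_lt_of_pos (k - a) (by omega : 0 < (m : ℤ))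
  have hb : circlePoint m (k : ℝ) = circlePoint m b := by
    have : ((k : ℤ) : ZMod m) = (b : ℤ) := by
      simp only [b]
      rw [Int.cast_add, ZMod.intCast_mod]; push_cast; ring
    rw [← circlePoint_eq_of_intCast_eq hm this]; norm_cast
  rw [Set.mem_ofPred_eq, hb]
  rcases (by omega : b = a ∨ b = a + 1 ∨ a + 2 ≤ b) with h | h | h
  · right; rw [h]; exact left_mem_segment _ _ _
  · right; rw [h]; exact right_mem_segment _ _ _
  · left; exact axisCoord_normalAngle_lt h (by omega)

theorem axisCoord_of_mem_polygonSide {m : ℕ} {a : ℤ} {q : ℂ} (hq : q ∈ polygonSide m a) :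
    axisCoord (normalAngle m a) q = Real.cos (Real.pi / m) := by
  obtain ⟨s, t, hs, ht, hst, rfl⟩ := hq
  rw [map_add, map_smul, map_smul, axisCoord_normalAngle_left, axisCoord_normalAngle_right,
    ← add_smul, hst, one_smul]

theorem axisCoord_le_of_mem_polygon {m : ℕ} (hm : 0 < m) (a : ℤ) {q : ℂ} (hq : q ∈ polygon m) :
    axisCoord (normalAngle m a) q ≤ Real.cos (Real.pi / m) :=
  (polygon_subset_halfSpace hm a hq).elim le_of_lt fun h => (axisCoord_of_mem_polygonSide h).le

theorem mem_polygonSide_of_axisCoord {m : ℕ} (hm : 0 < m) (a : ℤ) {q : ℂ} (hq : q ∈ polygon m)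
    (h : axisCoord (normalAngle m a) q = Real.cos (Real.pi / m)) : q ∈ polygonSide m a :=
  (polygon_subset_halfSpace hm a hq).resolve_left h.not_lt

/-- Sides that are not equal or adjacent are disjoint. -/
theorem disjoint_polygonSide {m : ℕ} {a b : ℤ} (h1 : a + 2 ≤ b) (h2 : b + 1 < a + m) :
    Disjoint (polygonSide m a) (polygonSide m b) := by
  rw [Set.disjoint_left]
  intro q hq hq'
  have h := axisCoord_of_mem_polygonSide hq
  obtain ⟨s, t, hs, ht, hst, rfl⟩ := hq'
  have e1 := axisCoord_normalAngle_lt h1 (by omega : b < a + m)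
  have e2 := axisCoord_normalAngle_lt (by omega : a + 2 ≤ b + 1) h2
  rw [map_add, map_smul, map_smul, smul_eq_mul, smul_eq_mul] at h
  set C := Real.cos (Real.pi / m)
  have eC : C = s * C + t * C := by rw [← add_mul, hst, one_mul]
  rcases hs.eq_or_lt with rfl | hs
  · have : t = 1 := by linarith
    subst this; linarith
  · nlinarith [mul_lt_mul_of_pos_left e1 hs, mul_le_mul_of_nonneg_left e2.le ht]

theorem disjoint_polygonEdge {m : ℕ} (hm : 0 < m) {i j : ZMod m} (h0 : i ≠ j) (h1 : j ≠ i + 1)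
    (h2 : i ≠ j + 1) : Disjoint (polygonEdge m i) (polygonEdge m j) := by
  have : NeZero m := ⟨hm.ne'⟩
  obtain ⟨a, rfl⟩ := ZMod.intCast_surjective i
  obtain ⟨k, rfl⟩ := ZMod.intCast_surjective j
  set b : ℤ := a + (k - a) % m
  have hmz : (m : ℤ) ≠ 0 := by omega
  have hb0 := Int.emod_nonneg (k - a) hmz
  have hb1 := Int.emod_lt_of_pos (k - a) (by omega : 0 < (m : ℤ))
  have hb : ((k : ℤ) : ZMod m) = (b : ℤ) := by
    simp only [b]
    rw [Int.cast_add, ZMod.intCast_mod]; push_cast; ring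
  rw [hb] at h0 h1 h2 ⊢
  rw [polygonEdge_intCast hm, polygonEdge_intCast hm]
  apply disjoint_polygonSide
  · by_contra hlt
    rcases (by omega : b = a ∨ b = a + 1) with h | h
    · exact h0 (by rw [h])
    · exact h1 (by rw [h]; push_cast; rfl)
  · by_contra hlt
    have h : b + 1 = a + m := by omega
    apply h2
    have := congrArg (Int.cast : ℤ → ZMod m) h
    push_cast at this
    simpa using this.symm

/-! ### Moves between colorings of the prism -/

theorem dir_add_apply (x : ℂ × ℝ) (s : ℝ) (d : ℂ × ℝ) :
    x + s • d = (x.1 + s • d.1, x.2 + s * d.2) := rfl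

/-- Rotation of the fibers of the prism over `ℂ`, by an amount depending on the base point. -/
noncomputable def verticalShear (m : ℕ) (h : ℂ → ℝ) (hc : Continuous h) (h0 : ∀ x, 0 ≤ h x)
    (h1 : ∀ x, h x ≤ 1) : Shear (prism m) where
  dir := (0, 1)
  coord x := x.2 - 1 / 2
  width _ := 1 / 2
  turn x := h x.1
  continuous_coord := by fun_prop
  continuous_width := by fun_prop
  continuous_turn := by fun_prop
  coord_add x s := by simp; ring
  width_add _ _ := rfl
  turn_add x s := by simp
  turn_nonneg x := h0 _
  turn_le_one x := h1 _
  abs_coord_le x hx := by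
    have := hx.2
    rw [abs_le]; constructor <;> linarith [this.1, this.2]
  mem_up x hx := by
    have h2 := hx.2
    have h3 := h0 x.1
    have h4 := h1 x.1
    have h5 : |1 / 2 - (x.2 - 1 / 2) - 2 * (1 / 2) * h x.1| ≤ 1 := by
      rw [abs_le]; constructor <;> linarith [h2.1, h2.2]
    have h6 := abs_nonneg (1 / 2 - (x.2 - 1 / 2) - 2 * (1 / 2) * h x.1)
    refine ⟨by simpa using hx.1, ?_⟩
    rw [dir_add_apply]
    constructor <;> simp only <;> linarith
  mem_down x hx := by
    have h2 := hx.2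
    have h3 := h0 x.1
    have h4 := h1 x.1
    have h5 : |1 / 2 + (x.2 - 1 / 2) - 2 * (1 / 2) * h x.1| ≤ 1 := by
      rw [abs_le]; constructor <;> linarith [h2.1, h2.2]
    have h6 := abs_nonneg (1 / 2 + (x.2 - 1 / 2) - 2 * (1 / 2) * h x.1)
    refine ⟨by simpa using hx.1, ?_⟩
    rw [dir_add_apply]
    constructor <;> simp only <;> linarith

/-- Vertical rotation: the colors of the side faces over which the rotation is a half turn change by
`λ(c) + λ(f)`. -/
theorem nonempty_homeomorph_of_vertical {m : ℕ} {lam lam' : PrismFacet m → (Fin 3 → ZMod 2)}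
    (hm : 0 < m)
    (l : (Fin 3 → ZMod 2) →+ ZMod 2)
    (hcl : l (lam .ceiling) = 1) (hfl : l (lam .floor) = 1)
    (hc : lam' .ceiling = lam .ceiling) (hf : lam' .floor = lam .floor)
    (hs : ∀ i, lam' (.side i) = lam (.side i) ∨ (l (lam (.side i)) = 1 ∧
      lam' (.side i) = lam (.side i) + lam .floor + lam .ceiling))
    (hadj : ∀ i, l (lam (.side i)) = 1 → l (lam (.side (i + 1))) = 1 →
      (lam' (.side i) = lam (.side i) ↔ lam' (.side (i + 1)) = lam (.side (i + 1)))) :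
    Nonempty (PrismSmallCover lam ≃ₜ PrismSmallCover lam') := by
  have : NeZero m := ⟨hm.ne'⟩
  have hclosed : ∀ i, IsClosed (polygonEdge m i) := by
    intro i
    rw [polygonEdge, segment_eq_image_lineMap]
    exact (isCompact_Icc.image AffineMap.lineMap_continuous).isClosed
  -- `K True` collects the edges with l = 1 that keep their color, `K False` those with l = 1 that
  -- change it. By `hadj` an edge of one kind is never adjacent to one of the other. Edges with l =
  -- 0 tolerate any amount of rotation.
  let K (p : Prop) : Set ℂ :=
    ⋃ i : {i : ZMod m // l (lam (.side i)) = 1 ∧ (lam' (.side i) = lam (.side i) ↔ p)},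
      polygonEdge m i.1
  have hK : ∀ p, IsClosed (K p) := fun p => isClosed_iUnion_of_finite fun i => hclosed _
  have hdisj : Disjoint (K True) (K False) := by
    simp only [K, Set.disjoint_iUnion_left, Set.disjoint_iUnion_right]
    rintro ⟨i, hi, hi'⟩ ⟨j, hj, hj'⟩
    simp only [iff_true, iff_false] at hi' hj' ⊢
    apply disjoint_polygonEdge hm
    · rintro rfl; exact hi' hj'
    · rintro rfl; exact hi' ((hadj j hj hi).1 hj')
    · rintro rfl; exact hi' ((hadj i hi hj).2 hj')
  -- Urysohn's lemma supplies the amount of rotation: none where the color is kept, full where it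
  -- changes.
  obtain ⟨h, h0, h1, h01⟩ := exists_continuous_zero_one_of_isClosed (hK True) (hK False) hdisj
  let S := verticalShear m h h.continuous (fun x => (h01 x).1) (fun x => (h01 x).2)
  have hup : ∀ x, ∃ t, S.up x = (x.1, t) := fun x => ⟨_, by
    rw [Shear.up, dir_add_apply]; simp [S, verticalShear]; rfl⟩
  have hdown : ∀ x, ∃ t, S.neg.up x = (x.1, t) := fun x => ⟨_, by
    rw [Shear.up, dir_add_apply]; simp [S, verticalShear, Shear.neg]; rfl⟩
  have hwall1 : ∀ lam : PrismFacet m → (Fin 3 → ZMod 2),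
      S.HasWall (prismFacet m) lam (lam .ceiling) := by
    intro lam x hx hxw
    refine ⟨.ceiling, ⟨?_, ?_⟩, rfl⟩
    · obtain ⟨t, ht⟩ := hup x
      rw [ht]; exact hx.1
    · have := S.coord_up_of_le hxw.le
      rw [hxw] at this
      simp only [S, verticalShear] at this ⊢
      rw [Set.mem_singleton_iff]; linarith
  have hwall0 : ∀ lam : PrismFacet m → (Fin 3 → ZMod 2),
      S.neg.HasWall (prismFacet m) lam (lam .floor) := by
    intro lam x hx hxw
    refine ⟨.floor, ⟨?_, ?_⟩, rfl⟩
    · obtain ⟨t, ht⟩ := hdown x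
      rw [ht]; exact hx.1
    · have := S.neg.coord_up_of_le hxw.le
      rw [hxw] at this
      simp only [S, verticalShear, Shear.neg] at this ⊢
      rw [Set.mem_singleton_iff]; linarith
  have hl0 : l (lam .ceiling + lam .floor) = 0 := by rw [map_add, hcl, hfl]; rfl
  -- Stated for a general pair because the situation is symmetric in λ and λ'; it serves for the map
  -- and for its inverse.
  have compat : ∀ mu mu' : PrismFacet m → (Fin 3 → ZMod 2),
      (∀ i, l (mu (.side i)) = l (lam (.side i))) → (mu' .ceiling = mu .ceiling) →
      (mu' .floor = mu .floor) → (∀ i, l (mu (.side i)) = 0 → mu' (.side i) = mu (.side i)) →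
      (∀ i, lam' (.side i) = lam (.side i) → mu' (.side i) = mu (.side i)) →
      (∀ i, lam' (.side i) ≠ lam (.side i) →
        mu' (.side i) = mu (.side i) + mu .floor + mu .ceiling) →
      ∀ i, ∀ x ∈ prism m, x ∈ prismFacet m i →
        S.CompatAt (prismFacet m) mu' l (mu .floor) (mu .ceiling) (mu i) x := by
    intro mu mu' hlm hmc hmf hm0 hmeq hmne i x hx hxi
    cases i with
    | ceiling =>
      refine Or.inl ⟨rfl, ?_⟩
      have := hxi.2
      rw [Set.mem_singleton_iff] at this
      simp only [S, verticalShear, this]; norm_num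
    | floor =>
      refine Or.inr (Or.inl ⟨rfl, ?_⟩)
      have := hxi.2
      rw [Set.mem_singleton_iff] at this
      simp only [S, verticalShear, this]; norm_num
    | side i =>
      refine Or.inr (Or.inr ?_)
      by_cases hli : l (mu (.side i)) = 0
      · refine Or.inl ⟨hli, ⟨.side i, ⟨?_, ?_⟩, hm0 i hli⟩, ⟨.side i, ⟨?_, ?_⟩, hm0 i hli⟩⟩
        · obtain ⟨t, ht⟩ := hup x
          rw [ht]; exact hxi.1
        · exact (S.up_mem hx).2
        · obtain ⟨t, ht⟩ := hdown x
          rw [ht]; exact hxi.1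
        · exact (S.neg.up_mem hx).2
      · have hli : l (mu (.side i)) = 1 := Shear.eq_add_one_of_ne hli
        refine Or.inr ?_
        by_cases hi : lam' (.side i) = lam (.side i)
        · refine Or.inl ⟨hli, ?_, .side i, hxi, hmeq i hi⟩
          exact h0 (Set.mem_iUnion.2 ⟨⟨i, by rw [← hlm, hli], by simpa using hi⟩, hxi.1⟩)
        · refine Or.inr ⟨hli, ?_, .side i, ⟨?_, ?_⟩, hmne i hi⟩
          · exact h1 (Set.mem_iUnion.2 ⟨⟨i, by rw [← hlm, hli], by simpa using hi⟩, hxi.1⟩)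
          · simpa [S, verticalShear] using hxi.1
          · have := hxi.2
            simp only [S, verticalShear, Prod.snd_sub, Prod.smul_snd, smul_eq_mul, mul_one]
            constructor <;> linarith [this.1, this.2]
  have hll : ∀ i, l (lam' (.side i)) = l (lam (.side i)) := by
    intro i
    rcases hs i with h | ⟨-, h⟩
    · rw [h]
    · rw [h, add_assoc, add_comm (lam .floor), map_add, hl0, add_zero]
  have e0 : ∀ i, l (lam (.side i)) = 0 → lam' (.side i) = lam (.side i) := by
    intro i hi
    refine (hs i).resolve_right ?_
    rintro ⟨h, -⟩; rw [hi] at h; exact absurd h (by decide)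
  refine S.nonempty_homeomorph l (lam .floor) (lam .ceiling) hfl hcl (hwall0 _) (hwall1 _)
    (hf ▸ hwall0 lam') (hc ▸ hwall1 lam') ?_ ?_
  · exact compat lam lam' (fun _ => rfl) hc hf e0 (fun i h => h)
      (fun i h => ((hs i).resolve_left h).2)
  · rw [← hc, ← hf]
    refine compat lam' lam hll hc.symm hf.symm ?_ (fun i h => h.symm) ?_
    · intro i hi
      rw [hll] at hi
      exact (e0 i hi).symm
    · intro i hi
      rw [((hs i).resolve_left hi).2, hc, hf, add_assoc (_ + _ + _), add_assoc (lam (.side i)),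
        SmallCover.add_add_cancel_two]

/-! ### Twisting the prism between two side faces -/

/-- The unit vector orthogonal to the direction of angle `θ`. -/
noncomputable def orthDir (θ : ℝ) : ℂ := ⟨-Real.sin θ, Real.cos θ⟩

theorem axisCoord_orthDir (θ : ℝ) : axisCoord θ (orthDir θ) = 0 := by
  rw [axisCoord_apply, orthDir]; ring

theorem orthCoord_orthDir (θ : ℝ) : orthCoord θ (orthDir θ) = 1 := by
  rw [orthCoord_apply, orthDir]
  linear_combination Real.sin_sq_add_cos_sq θ

theorem axisCoord_add_smul (θ : ℝ) (q : ℂ) (s : ℝ) :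
    axisCoord θ (q + s • orthDir θ) = axisCoord θ q := by
  rw [map_add, map_smul, axisCoord_orthDir, smul_zero, add_zero]

theorem orthCoord_add_smul (θ : ℝ) (q : ℂ) (s : ℝ) :
    orthCoord θ (q + s • orthDir θ) = orthCoord θ q + s := by
  rw [map_add, map_smul, orthCoord_orthDir, smul_eq_mul, mul_one]

theorem continuous_axisCoord (θ : ℝ) : Continuous (axisCoord θ) :=
  LinearMap.continuous_of_finiteDimensional _

theorem continuous_orthCoord (θ : ℝ) : Continuous (orthCoord θ) :=
  LinearMap.continuous_of_finiteDimensional _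

/-- The reflection in the line of angle `θ`. -/
noncomputable def axisReflection (θ : ℝ) : ℂ →ₗ[ℝ] ℂ :=
  LinearMap.id - (2 : ℝ) • (orthCoord θ).smulRight (orthDir θ)

theorem axisReflection_apply (θ : ℝ) (q : ℂ) :
    axisReflection θ q = q - (2 * orthCoord θ q) • orthDir θ := by
  simp only [axisReflection, LinearMap.sub_apply, LinearMap.id_apply, LinearMap.smul_apply,
    LinearMap.smulRight_apply, smul_smul]

/-- Two sides `i < k` of the polygon. -/
structure SidePair (m : ℕ) where
  /-- the first side -/
  i : ℤ
  /-- the second side -/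
  k : ℤ
  lt : i < k
  lt_add : k < i + m

namespace SidePair

variable {m : ℕ} (D : SidePair m)

/-- The angle of the axis of symmetry exchanging the two sides. -/
noncomputable def axis : ℝ := Real.pi * (D.i + D.k + 1) / m

/-- Half of the angle between the normals of the sides. -/
noncomputable def gap : ℝ := Real.pi * (D.k - D.i) / m

/-- The height of the vertices `i + 1` and `k` above the center. -/
noncomputable def upper : ℝ := Real.cos (D.gap - Real.pi / m)

/-- The height of the vertices `i` and `k + 1` above the center. -/
noncomputable def lower : ℝ := Real.cos (D.gap + Real.pi / m)

/-- The height along the axis. -/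
noncomputable def height (q : ℂ) : ℝ := axisCoord D.axis q

/-- The coordinate orthogonal to the axis. -/
noncomputable def offset (q : ℂ) : ℝ := orthCoord D.axis q

/-- The offset at which the lines spanned by the two sides are met. -/
noncomputable def halfWidth (q : ℂ) : ℝ :=
  (Real.cos (Real.pi / m) - Real.cos D.gap * D.height q) / Real.sin D.gap

/-- The amount of rotation, growing from `0` to `1` between the two sides. -/
noncomputable def amount (q : ℂ) : ℝ :=
  max 0 (min 1 ((D.height q - D.lower) / (D.upper - D.lower)))

theorem pos (D : SidePair m) : 0 < m := by
  have := D.lt; have := D.lt_add; omega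

theorem cast_pos (D : SidePair m) : (0 : ℝ) < m := by exact_mod_cast D.pos

theorem one_le_sub : (1 : ℝ) ≤ D.k - D.i := by
  have := D.lt
  have : 1 ≤ D.k - D.i := by omega
  exact_mod_cast this

theorem sub_le : (D.k - D.i : ℝ) ≤ m - 1 := by
  have := D.lt_add
  have : D.k - D.i ≤ m - 1 := by omega
  exact_mod_cast this

theorem gap_sub_nonneg : 0 ≤ D.gap - Real.pi / m := by
  have := D.cast_pos
  have h := D.one_le_sub
  rw [gap, ← sub_div]
  have hp := Real.pi_pos
  apply div_nonneg _ this.le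
  nlinarith

theorem gap_add_le : D.gap + Real.pi / m ≤ Real.pi := by
  have := D.cast_pos
  have h := D.sub_le
  have hp := Real.pi_pos
  rw [gap, ← add_div, div_le_iff₀ this]
  nlinarith

theorem pi_div_pos (D : SidePair m) : 0 < Real.pi / m := div_pos Real.pi_pos D.cast_pos

theorem sin_gap_pos : 0 < Real.sin D.gap := by
  have := D.pi_div_pos
  have := D.gap_sub_nonneg
  have := D.gap_add_le
  apply Real.sin_pos_of_pos_of_lt_pi <;> linarith

theorem lower_lt_upper : D.lower < D.upper := by
  have := D.pi_div_pos
  exact Real.cos_lt_cos_of_nonneg_of_le_pi D.gap_sub_nonneg D.gap_add_le (by linarith)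

theorem normalAngle_k : normalAngle m D.k = D.axis + D.gap := by
  rw [normalAngle, axis, gap]; ring

theorem normalAngle_i : normalAngle m D.i = D.axis - D.gap := by
  rw [normalAngle, axis, gap]; ring

/-- The normal of side k makes the angle `gap` with the axis, so the line of this side is
cos(gap)·height + sin(gap)·offset = cos(π/m); `halfWidth` is its solution for the offset. -/
theorem offset_le_iff {q : ℂ} : D.offset q ≤ D.halfWidth q ↔
    axisCoord (normalAngle m D.k) q ≤ Real.cos (Real.pi / m) := by
  rw [halfWidth, le_div_iff₀ D.sin_gap_pos, normalAngle_k, axisCoord_add, height, offset]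
  constructor <;> intro <;> linarith

theorem offset_eq_iff {q : ℂ} : D.offset q = D.halfWidth q ↔
    axisCoord (normalAngle m D.k) q = Real.cos (Real.pi / m) := by
  rw [halfWidth, eq_div_iff D.sin_gap_pos.ne', normalAngle_k, axisCoord_add, height, offset]
  constructor <;> intro <;> linarith

theorem neg_le_offset_iff {q : ℂ} : -D.halfWidth q ≤ D.offset q ↔
    axisCoord (normalAngle m D.i) q ≤ Real.cos (Real.pi / m) := by
  rw [neg_le, halfWidth, le_div_iff₀ D.sin_gap_pos, normalAngle_i, axisCoord_sub, height, offset]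
  constructor <;> intro <;> linarith

theorem offset_eq_neg_iff {q : ℂ} : D.offset q = -D.halfWidth q ↔
    axisCoord (normalAngle m D.i) q = Real.cos (Real.pi / m) := by
  rw [eq_neg_iff_add_eq_zero, add_comm, ← eq_neg_iff_add_eq_zero, halfWidth,
    div_eq_iff D.sin_gap_pos.ne', normalAngle_i, axisCoord_sub, height, offset]
  constructor <;> intro <;> linarith

theorem abs_offset_le {q : ℂ} (hq : q ∈ polygon m) : |D.offset q| ≤ D.halfWidth q :=
  abs_le.2 ⟨D.neg_le_offset_iff.2 (axisCoord_le_of_mem_polygon D.pos _ hq),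
    D.offset_le_iff.2 (axisCoord_le_of_mem_polygon D.pos _ hq)⟩

theorem mem_side_k {q : ℂ} (hq : q ∈ polygon m) (h : D.offset q = D.halfWidth q) :
    q ∈ polygonSide m D.k := mem_polygonSide_of_axisCoord D.pos _ hq (D.offset_eq_iff.1 h)

theorem mem_side_i {q : ℂ} (hq : q ∈ polygon m) (h : D.offset q = -D.halfWidth q) :
    q ∈ polygonSide m D.i := mem_polygonSide_of_axisCoord D.pos _ hq (D.offset_eq_neg_iff.1 h)

theorem height_add_smul (q : ℂ) (s : ℝ) : D.height (q + s • orthDir D.axis) = D.height q :=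
  axisCoord_add_smul _ _ _

theorem offset_add_smul (q : ℂ) (s : ℝ) : D.offset (q + s • orthDir D.axis) = D.offset q + s :=
  orthCoord_add_smul _ _ _

theorem halfWidth_add_smul (q : ℂ) (s : ℝ) :
    D.halfWidth (q + s • orthDir D.axis) = D.halfWidth q := by
  rw [halfWidth, height_add_smul, halfWidth]

theorem amount_add_smul (q : ℂ) (s : ℝ) : D.amount (q + s • orthDir D.axis) = D.amount q := by
  rw [amount, height_add_smul, amount]

theorem height_circlePoint (a : ℤ) :
    D.height (circlePoint m a) = Real.cos (2 * Real.pi * (a - (D.i + D.k + 1) / 2) / m) := by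
  rw [height, axisCoord_circlePoint, axis]
  congr 1; ring

theorem upper_eq : D.upper = Real.cos (2 * Real.pi * ((D.k - D.i - 1) / 2) / m) := by
  rw [upper, gap]; congr 1; ring

theorem lower_eq : D.lower = Real.cos (2 * Real.pi * ((D.k - D.i + 1) / 2) / m) := by
  rw [lower, gap]; congr 1; ring

theorem height_k : D.height (circlePoint m D.k) = D.upper := by
  rw [height_circlePoint, upper_eq]; congr 1; ring

theorem height_k_succ : D.height (circlePoint m (D.k + 1 : ℤ)) = D.lower := by
  rw [height_circlePoint, lower_eq]; congr 1; push_cast; ring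

theorem height_i_succ : D.height (circlePoint m (D.i + 1 : ℤ)) = D.upper := by
  rw [height_circlePoint, upper_eq, ← Real.cos_neg]; congr 1; push_cast; ring

theorem height_i : D.height (circlePoint m D.i) = D.lower := by
  rw [height_circlePoint, lower_eq, ← Real.cos_neg]; congr 1; ring

/-- The vertices i + 1, …, k lie on the arc around the axis bounded by i + 1 and k, and cosine
decreases away from the axis. -/
theorem upper_le_height_circlePoint {a : ℤ} (h1 : D.i + 1 ≤ a) (h2 : a ≤ D.k) :
    D.upper ≤ D.height (circlePoint m a) := by
  have h1' : (D.i + 1 : ℝ) ≤ a := by exact_mod_cast h1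
  have h2' : (a : ℝ) ≤ D.k := by exact_mod_cast h2
  have hp := Real.pi_pos
  have hm := D.cast_pos
  have h := D.sub_le
  rw [height_circlePoint, upper_eq, ← Real.cos_abs, ← Real.cos_abs (2 * Real.pi * _ / m)]
  have e : ∀ x : ℝ, |2 * Real.pi * x / m| = 2 * Real.pi * |x| / m := by
    intro x
    rw [abs_div, abs_mul, abs_of_pos (by positivity : 0 < 2 * Real.pi), abs_of_pos hm]
  rw [e, e]
  have h3 : |(D.k - D.i - 1 : ℝ) / 2| = (D.k - D.i - 1) / 2 :=
    abs_of_nonneg (by linarith)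
  apply Real.cos_le_cos_of_nonneg_of_le_pi
  · positivity
  · rw [h3, div_le_iff₀ hm]; nlinarith
  · rw [h3]
    gcongr
    rw [abs_le]; constructor <;> linarith

theorem height_circlePoint_le_lower {a : ℤ} (h1 : D.k + 1 ≤ a) (h2 : a ≤ D.i + m) :
    D.height (circlePoint m a) ≤ D.lower := by
  have h1' : (D.k + 1 : ℝ) ≤ a := by exact_mod_cast h1
  have h2' : (a : ℝ) ≤ D.i + m := by exact_mod_cast h2
  have h := D.one_le_sub
  rw [height_circlePoint, lower_eq]
  apply cos_le_cos_of_mem_Icc D.cast_pos <;> linarith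

theorem upper_le_height {a : ℤ} (h1 : D.i < a) (h2 : a < D.k) {q : ℂ}
    (hq : q ∈ polygonSide m a) : D.upper ≤ D.height q := by
  have e1 := D.upper_le_height_circlePoint (a := a) (by omega) (by omega)
  have e2 := D.upper_le_height_circlePoint (a := a + 1) (by omega) (by omega)
  obtain ⟨s, t, hs, ht, hst, rfl⟩ := hq
  rw [height] at e1 e2 ⊢
  rw [map_add, map_smul, map_smul, smul_eq_mul, smul_eq_mul]
  calc D.upper = s * D.upper + t * D.upper := by rw [← add_mul, hst, one_mul]
    _ ≤ _ := by gcongr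

theorem height_le_lower {a : ℤ} (h1 : D.k < a) (h2 : a < D.i + m) {q : ℂ}
    (hq : q ∈ polygonSide m a) : D.height q ≤ D.lower := by
  have e1 := D.height_circlePoint_le_lower (a := a) (by omega) (by omega)
  have e2 := D.height_circlePoint_le_lower (a := a + 1) (by omega) (by omega)
  obtain ⟨s, t, hs, ht, hst, rfl⟩ := hq
  rw [height] at e1 e2 ⊢
  rw [map_add, map_smul, map_smul, smul_eq_mul, smul_eq_mul]
  calc _ ≤ s * D.lower + t * D.lower := by gcongr
    _ = D.lower := by rw [← add_mul, hst, one_mul]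

theorem amount_nonneg (q : ℂ) : 0 ≤ D.amount q := le_max_left _ _

theorem amount_le_one (q : ℂ) : D.amount q ≤ 1 := max_le zero_le_one (min_le_left _ _)

theorem amount_eq_zero {q : ℂ} (h : D.height q ≤ D.lower) : D.amount q = 0 := by
  have := D.lower_lt_upper
  refine max_eq_left ((min_le_right _ _).trans ?_)
  exact div_nonpos_of_nonpos_of_nonneg (by linarith) (by linarith)

theorem amount_eq_one {q : ℂ} (h : D.upper ≤ D.height q) : D.amount q = 1 := by
  have := D.lower_lt_upper
  have h1 : 1 ≤ (D.height q - D.lower) / (D.upper - D.lower) := by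
    rw [le_div_iff₀ (by linarith)]; linarith
  rw [amount, min_eq_left h1, max_eq_right zero_le_one]

/-- Height is affine along side k and runs between `lower` and `upper`, so interpolating the end
points gives a point p of the side at the height of q. Lying on the line of the side, p has offset
`halfWidth`. -/
theorem right_end_mem {q : ℂ} (h0 : D.lower ≤ D.height q) (h1 : D.height q ≤ D.upper) :
    q + (D.halfWidth q - D.offset q) • orthDir D.axis ∈ polygonSide m D.k := by
  have hlt := D.lower_lt_upper
  have hpos : 0 < D.upper - D.lower := by linarith
  set s := (D.height q - D.lower) / (D.upper - D.lower) with hs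
  have hs0 : 0 ≤ s := div_nonneg (by linarith) hpos.le
  have hs1 : s ≤ 1 := by rw [hs, div_le_one hpos]; linarith
  have hse : s * (D.upper - D.lower) = D.height q - D.lower := div_mul_cancel₀ _ hpos.ne'
  have key : q + (D.halfWidth q - D.offset q) • orthDir D.axis =
      s • circlePoint m D.k + (1 - s) • circlePoint m (D.k + 1 : ℤ) := by
    set p := s • circlePoint m D.k + (1 - s) • circlePoint m (D.k + 1 : ℤ) with hp
    have hpk : p ∈ polygonSide m D.k := ⟨s, 1 - s, hs0, by linarith, by ring, rfl⟩
    have hph : D.height p = D.height q := by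
      have e1 := D.height_k
      have e2 := D.height_k_succ
      rw [height] at e1 e2 ⊢
      rw [hp, map_add, map_smul, map_smul, e1, e2, smul_eq_mul, smul_eq_mul]
      linarith
    refine ext_coord (θ := D.axis) ((D.height_add_smul _ _).trans hph.symm) ?_
    refine (D.offset_add_smul _ _).trans ?_
    have := D.offset_eq_iff.2 (axisCoord_of_mem_polygonSide hpk)
    rw [halfWidth, hph] at this
    change _ = D.offset p
    rw [this, halfWidth]; ring
  rw [key]
  exact ⟨s, 1 - s, hs0, by linarith, by ring, rfl⟩

theorem left_end_mem {q : ℂ} (h0 : D.lower ≤ D.height q) (h1 : D.height q ≤ D.upper) :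
    q + (-D.halfWidth q - D.offset q) • orthDir D.axis ∈ polygonSide m D.i := by
  have hlt := D.lower_lt_upper
  have hpos : 0 < D.upper - D.lower := by linarith
  set s := (D.height q - D.lower) / (D.upper - D.lower) with hs
  have hs0 : 0 ≤ s := div_nonneg (by linarith) hpos.le
  have hs1 : s ≤ 1 := by rw [hs, div_le_one hpos]; linarith
  have hse : s * (D.upper - D.lower) = D.height q - D.lower := div_mul_cancel₀ _ hpos.ne'
  have key : q + (-D.halfWidth q - D.offset q) • orthDir D.axis =
      (1 - s) • circlePoint m D.i + s • circlePoint m (D.i + 1 : ℤ) := by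
    set p := (1 - s) • circlePoint m D.i + s • circlePoint m (D.i + 1 : ℤ) with hp
    have hpk : p ∈ polygonSide m D.i := ⟨1 - s, s, by linarith, hs0, by ring, rfl⟩
    have hph : D.height p = D.height q := by
      have e1 := D.height_i
      have e2 := D.height_i_succ
      rw [height] at e1 e2 ⊢
      rw [hp, map_add, map_smul, map_smul, e1, e2, smul_eq_mul, smul_eq_mul]
      linarith
    refine ext_coord (θ := D.axis) ((D.height_add_smul _ _).trans hph.symm) ?_
    refine (D.offset_add_smul _ _).trans ?_
    have := D.offset_eq_neg_iff.2 (axisCoord_of_mem_polygonSide hpk)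
    rw [halfWidth, hph] at this
    change _ = D.offset p
    rw [this, halfWidth]; ring
  rw [key]
  exact ⟨1 - s, s, by linarith, hs0, by ring, rfl⟩

theorem reflection_circlePoint (a : ℤ) :
    axisReflection D.axis (circlePoint m a) = circlePoint m (D.i + D.k + 1 - a : ℤ) := by
  have e : 2 * Real.pi * (D.i + D.k + 1 - a : ℤ) / m - D.axis =
      -(2 * Real.pi * a / m - D.axis) := by
    rw [axis]; push_cast; ring
  apply ext_coord (θ := D.axis)
  · rw [axisReflection_apply, sub_eq_add_neg, ← neg_smul, axisCoord_add_smul,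
      axisCoord_circlePoint, axisCoord_circlePoint, e, Real.cos_neg]
  · rw [axisReflection_apply, sub_eq_add_neg, ← neg_smul, orthCoord_add_smul,
      orthCoord_circlePoint, orthCoord_circlePoint, e, Real.sin_neg]
    ring

theorem reflection_mem_polygon {q : ℂ} (hq : q ∈ polygon m) :
    axisReflection D.axis q ∈ polygon m := by
  have : axisReflection D.axis '' polygon m ⊆ polygon m := by
    rw [polygon, LinearMap.image_convexHull]
    refine convexHull_mono ?_
    rintro _ ⟨_, ⟨k, rfl⟩, rfl⟩
    have := D.reflection_circlePoint k
    rw [Int.cast_natCast] at this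
    rw [polygonVertex_eq, this]
    exact circlePoint_mem_range D.pos _
  exact this ⟨q, hq, rfl⟩

/-- The reflection exchanges the first and second end points of sides, so the index is one less than
for vertices. -/
theorem reflection_mem_side {q : ℂ} {a : ℤ} (hq : q ∈ polygonSide m a) :
    axisReflection D.axis q ∈ polygonSide m (D.i + D.k - a) := by
  obtain ⟨s, t, hs, ht, hst, rfl⟩ := hq
  refine ⟨t, s, ht, hs, by rw [add_comm, hst], ?_⟩
  rw [map_add, map_smul, map_smul, D.reflection_circlePoint, D.reflection_circlePoint, add_comm]
  congr 4 <;> ring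

theorem mem_polygon_of_between {q : ℂ} {t : ℝ}
    (ht : |t| ≤ D.halfWidth q) (h0 : D.lower ≤ D.height q) (h1 : D.height q ≤ D.upper) :
    q + (t - D.offset q) • orthDir D.axis ∈ polygon m := by
  have hl := polygonSide_subset D.pos _ (D.left_end_mem h0 h1)
  have hr := polygonSide_subset D.pos _ (D.right_end_mem h0 h1)
  have hconv : Convex ℝ {s : ℝ | q + s • orthDir D.axis ∈ polygon m} := by
    intro x hx y hy a b ha hb hab
    have := convex_polygon m hx hy ha hb hab
    have e : a • (q + x • orthDir D.axis) + b • (q + y • orthDir D.axis) =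
        q + (a • x + b • y) • orthDir D.axis := by
      have : q = a • q + b • q := by rw [← add_smul, hab, one_smul]
      nth_rw 3 [this]
      module
    rwa [e] at this
  have ht := abs_le.1 ht
  exact hconv.ordConnected.out hl hr ⟨by linarith, by linarith⟩

/-- Partial rotation happens only at heights where the polygon fills the whole interval between the
two sides. Beyond them it may be narrower, but there the twist is the identity or the reflection,
both of which preserve the polygon. -/
theorem trichotomy (q : ℂ) : D.amount q = 0 ∨ D.amount q = 1 ∨
    (D.lower ≤ D.height q ∧ D.height q ≤ D.upper) := by
  rcases le_total (D.height q) D.lower with h | h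
  · exact Or.inl (D.amount_eq_zero h)
  rcases le_total D.upper (D.height q) with h' | h'
  · exact Or.inr (Or.inl (D.amount_eq_one h'))
  · exact Or.inr (Or.inr ⟨h, h'⟩)

theorem continuous_height : Continuous D.height := continuous_axisCoord _

theorem continuous_offset : Continuous D.offset := continuous_orthCoord _

theorem continuous_halfWidth : Continuous D.halfWidth :=
  ((continuous_const.sub (continuous_const.mul D.continuous_height)).div_const _)

theorem continuous_amount : Continuous D.amount :=
  continuous_const.max (continuous_const.min ((D.continuous_height.sub continuous_const).div_const _))

theorem up_mem_polygon {q : ℂ} (hq : q ∈ polygon m) :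
    q + (D.halfWidth q - |D.halfWidth q - D.offset q - 2 * D.halfWidth q * D.amount q| -
      D.offset q) • orthDir D.axis ∈ polygon m := by
  have h := abs_le.1 (D.abs_offset_le hq)
  have hW := (abs_nonneg _).trans (D.abs_offset_le hq)
  rcases D.trichotomy q with h0 | h1 | h2
  · rw [h0, abs_of_nonneg (by linarith)]
    convert hq
    simp
  · rw [h1, abs_of_nonpos (by linarith)]
    convert D.reflection_mem_polygon hq using 1
    rw [axisReflection_apply, sub_eq_add_neg q, ← neg_smul]
    congr 2
    rw [offset]; ring
  · refine D.mem_polygon_of_between ?_ h2.1 h2.2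
    have h3 := mul_nonneg hW (D.amount_nonneg q)
    have h4 := mul_le_mul_of_nonneg_left (D.amount_le_one q) hW
    have h5 : |D.halfWidth q - D.offset q - 2 * D.halfWidth q * D.amount q| ≤
        2 * D.halfWidth q := by
      rw [abs_le]; constructor <;> linarith
    have h6 := abs_nonneg (D.halfWidth q - D.offset q - 2 * D.halfWidth q * D.amount q)
    rw [abs_le]; constructor <;> linarith

theorem down_mem_polygon {q : ℂ} (hq : q ∈ polygon m) :
    q + (|D.halfWidth q + D.offset q - 2 * D.halfWidth q * D.amount q| - D.halfWidth q -
      D.offset q) • orthDir D.axis ∈ polygon m := by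
  have h := abs_le.1 (D.abs_offset_le hq)
  have hW := (abs_nonneg _).trans (D.abs_offset_le hq)
  rcases D.trichotomy q with h0 | h1 | h2
  · rw [h0, abs_of_nonneg (by linarith)]
    convert hq
    simp
  · rw [h1, abs_of_nonpos (by linarith)]
    convert D.reflection_mem_polygon hq using 1
    rw [axisReflection_apply, sub_eq_add_neg q, ← neg_smul]
    congr 2
    rw [offset]; ring
  · refine D.mem_polygon_of_between ?_ h2.1 h2.2
    have h3 := mul_nonneg hW (D.amount_nonneg q)
    have h4 := mul_le_mul_of_nonneg_left (D.amount_le_one q) hW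
    have h5 : |D.halfWidth q + D.offset q - 2 * D.halfWidth q * D.amount q| ≤
        2 * D.halfWidth q := by
      rw [abs_le]; constructor <;> linarith
    have h6 := abs_nonneg (D.halfWidth q + D.offset q - 2 * D.halfWidth q * D.amount q)
    rw [abs_le]; constructor <;> linarith

/-- The twist of the prism between two sides. -/
noncomputable def shear : Shear (prism m) where
  dir := (orthDir D.axis, 0)
  coord x := D.offset x.1
  width x := D.halfWidth x.1
  turn x := D.amount x.1
  continuous_coord := D.continuous_offset.comp continuous_fst
  continuous_width := D.continuous_halfWidth.comp continuous_fst
  continuous_turn := D.continuous_amount.comp continuous_fst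
  coord_add x s := D.offset_add_smul _ _
  width_add x s := D.halfWidth_add_smul _ _
  turn_add x s := D.amount_add_smul _ _
  turn_nonneg x := D.amount_nonneg _
  turn_le_one x := D.amount_le_one _
  abs_coord_le x hx := D.abs_offset_le hx.1
  mem_up x hx := ⟨D.up_mem_polygon hx.1, by simpa [dir_add_apply] using hx.2⟩
  mem_down x hx := ⟨D.down_mem_polygon hx.1, by simpa [dir_add_apply] using hx.2⟩

theorem shear_reflect (x : ℂ × ℝ) : x - (2 * D.shear.coord x) • D.shear.dir =
    (axisReflection D.axis x.1, x.2) := by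
  rw [axisReflection_apply, sub_eq_add_neg, ← neg_smul, dir_add_apply, sub_eq_add_neg, ← neg_smul]
  simp [shear, offset]

theorem shear_up_snd (x : ℂ × ℝ) : (D.shear.up x).2 = x.2 := by
  rw [Shear.up, dir_add_apply]; simp [shear]

theorem shear_neg_up_snd (x : ℂ × ℝ) : (D.shear.neg.up x).2 = x.2 := by
  rw [Shear.up, dir_add_apply]; simp [shear, Shear.neg]

theorem side_mem (hm : 0 < m) {x : ℂ × ℝ} {a : ℤ} (h1 : x.1 ∈ polygonSide m a)
    (h2 : x.2 ∈ Set.Icc (0 : ℝ) 1) : x ∈ prismFacet m (.side (a : ZMod m)) :=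
  ⟨by rw [polygonEdge_intCast hm]; exact h1, h2⟩

/-- A point arriving exactly at the wall is already on side k if the turn is 0. If the turn is 1 it
starts on side i, which the reflection carries to side k. Otherwise it is the right end point of its
segment. -/
theorem hasWall {lam : PrismFacet m → (Fin 3 → ZMod 2)} :
    D.shear.HasWall (prismFacet m) lam (lam (.side (D.k : ZMod m))) := by
  intro x hx h
  have hc := abs_le.1 (D.abs_offset_le hx.1)
  refine ⟨_, side_mem D.pos ?_ (D.shear.up_mem hx).2, rfl⟩
  rcases D.trichotomy x.1 with h0 | h1 | h2
  · rw [D.shear.up_eq_self hx h0]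
    change D.offset x.1 + 2 * D.halfWidth x.1 * D.amount x.1 = D.halfWidth x.1 at h
    exact D.mem_side_k hx.1 (by rw [h0] at h; linarith)
  · rw [D.shear.up_eq_reflect hx h1, shear_reflect]
    change D.offset x.1 + 2 * D.halfWidth x.1 * D.amount x.1 = D.halfWidth x.1 at h
    have := D.reflection_mem_side (D.mem_side_i hx.1 (by rw [h1] at h; linarith))
    rwa [add_sub_cancel_left] at this
  · have := D.right_end_mem h2.1 h2.2
    rw [D.shear.up_eq_of_le h.le, dir_add_apply]
    change D.offset x.1 + 2 * D.halfWidth x.1 * D.amount x.1 = D.halfWidth x.1 at h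
    rwa [← eq_sub_iff_add_eq'.2 h] at this

theorem hasWall_neg {lam : PrismFacet m → (Fin 3 → ZMod 2)} :
    D.shear.neg.HasWall (prismFacet m) lam (lam (.side (D.i : ZMod m))) := by
  intro x hx h
  have hc := abs_le.1 (D.abs_offset_le hx.1)
  refine ⟨_, side_mem D.pos ?_ (D.shear.neg.up_mem hx).2, rfl⟩
  rcases D.trichotomy x.1 with h0 | h1 | h2
  · rw [D.shear.neg.up_eq_self hx h0]
    change -D.offset x.1 + 2 * D.halfWidth x.1 * D.amount x.1 = D.halfWidth x.1 at h
    exact D.mem_side_i hx.1 (by rw [h0] at h; linarith)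
  · rw [D.shear.neg_up_eq_reflect hx h1, shear_reflect]
    change -D.offset x.1 + 2 * D.halfWidth x.1 * D.amount x.1 = D.halfWidth x.1 at h
    have := D.reflection_mem_side (D.mem_side_k hx.1 (by rw [h1] at h; linarith))
    rwa [add_sub_cancel_right] at this
  · have := D.left_end_mem h2.1 h2.2
    rw [D.shear.neg.up_eq_of_le h.le, dir_add_apply]
    change -D.offset x.1 + 2 * D.halfWidth x.1 * D.amount x.1 = D.halfWidth x.1 at h
    change x.1 + (2 * D.halfWidth x.1 * D.amount x.1) • (-orthDir D.axis) ∈ _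
    rw [smul_neg, ← neg_smul]
    convert this using 3
    linarith

/-- Horizontal twist: if neither the ceiling nor the floor changes sheets, the colors strictly
between the sides `i` and `k` may be reversed. -/
theorem nonempty_homeomorph {lam lam' : PrismFacet m → (Fin 3 → ZMod 2)}
    (l : (Fin 3 → ZMod 2) →+ ZMod 2)
    (hcl : l (lam .ceiling) = 0) (hfl : l (lam .floor) = 0)
    (hc : lam' .ceiling = lam .ceiling) (hf : lam' .floor = lam .floor)
    (hil : l (lam (.side (D.i : ZMod m))) = 1) (hkl : l (lam (.side (D.k : ZMod m))) = 1)
    (hi : lam' (.side (D.i : ZMod m)) = lam (.side (D.i : ZMod m)))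
    (hout : ∀ a : ℤ, D.k ≤ a → a < D.i + m →
      lam' (.side (a : ZMod m)) = lam (.side (a : ZMod m)))
    (hin0 : ∀ a : ℤ, D.i < a → a < D.k → l (lam (.side (a : ZMod m))) = 0 →
      lam' (.side ((D.i + D.k - a : ℤ) : ZMod m)) = lam (.side (a : ZMod m)))
    (hin1 : ∀ a : ℤ, D.i < a → a < D.k → l (lam (.side (a : ZMod m))) = 1 →
      lam' (.side ((D.i + D.k - a : ℤ) : ZMod m)) = lam (.side (a : ZMod m)) +
        lam (.side (D.i : ZMod m)) + lam (.side (D.k : ZMod m))) :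
    Nonempty (PrismSmallCover lam ≃ₜ PrismSmallCover lam') := by
  have hk := hout D.k le_rfl D.lt_add
  have compat : ∀ mu mu' : PrismFacet m → (Fin 3 → ZMod 2),
      l (mu .ceiling) = 0 → l (mu .floor) = 0 →
      mu' .ceiling = mu .ceiling → mu' .floor = mu .floor →
      (∀ a : ℤ, D.k ≤ a → a < D.i + m →
        mu' (.side (a : ZMod m)) = mu (.side (a : ZMod m))) →
      (∀ a : ℤ, D.i < a → a < D.k → l (mu (.side (a : ZMod m))) = 0 →
        mu' (.side ((D.i + D.k - a : ℤ) : ZMod m)) = mu (.side (a : ZMod m))) →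
      (∀ a : ℤ, D.i < a → a < D.k → l (mu (.side (a : ZMod m))) = 1 →
        mu' (.side ((D.i + D.k - a : ℤ) : ZMod m)) = mu (.side (a : ZMod m)) +
          mu (.side (D.i : ZMod m)) + mu (.side (D.k : ZMod m))) →
      ∀ f, ∀ x ∈ prism m, x ∈ prismFacet m f →
        D.shear.CompatAt (prismFacet m) mu' l (mu (.side (D.i : ZMod m)))
          (mu (.side (D.k : ZMod m))) (mu f) x := by
    intro mu mu' hcl hfl hc hf hout hin0 hin1 f x hx hxf
    cases f with
    | ceiling =>
      refine Or.inr (Or.inr (Or.inl ⟨hcl, ⟨.ceiling, ⟨(D.shear.up_mem hx).1, ?_⟩, hc⟩,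
        ⟨.ceiling, ⟨(D.shear.neg.up_mem hx).1, ?_⟩, hc⟩⟩))
      · rw [shear_up_snd]; exact hxf.2
      · rw [shear_neg_up_snd]; exact hxf.2
    | floor =>
      refine Or.inr (Or.inr (Or.inl ⟨hfl, ⟨.floor, ⟨(D.shear.up_mem hx).1, ?_⟩, hf⟩,
        ⟨.floor, ⟨(D.shear.neg.up_mem hx).1, ?_⟩, hf⟩⟩))
      · rw [shear_up_snd]; exact hxf.2
      · rw [shear_neg_up_snd]; exact hxf.2
    | side i =>
      obtain ⟨a, ha0, ha1, rfl⟩ : ∃ a : ℤ, D.i ≤ a ∧ a < D.i + m ∧ (a : ZMod m) = i := by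
        obtain ⟨b, rfl⟩ := ZMod.intCast_surjective i
        have hmz : (m : ℤ) ≠ 0 := by have := D.pos; omega
        have hb0 := Int.emod_nonneg (b - D.i) hmz
        have hb1 := Int.emod_lt_of_pos (b - D.i) (by have := D.pos; omega : 0 < (m : ℤ))
        refine ⟨D.i + (b - D.i) % m, by omega, by omega, ?_⟩
        rw [Int.cast_add, ZMod.intCast_mod]; push_cast; ring
      have hx1 := hxf.1
      rw [polygonEdge_intCast D.pos] at hx1
      rcases ha0.eq_or_lt with rfl | ha0
      · exact Or.inr (Or.inl ⟨rfl, D.offset_eq_neg_iff.2 (axisCoord_of_mem_polygonSide hx1)⟩)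
      rcases eq_or_ne a D.k with rfl | hak
      · exact Or.inl ⟨rfl, D.offset_eq_iff.2 (axisCoord_of_mem_polygonSide hx1)⟩
      refine Or.inr (Or.inr ?_)
      rcases hak.lt_or_gt with hak | hak
      -- Sides strictly between i and k lie above `upper`, where both directions of rotation
      -- reflect; those beyond k lie below `lower`, where nothing moves.
      · have h1 : D.shear.turn x = 1 := D.amount_eq_one (D.upper_le_height ha0 hak hx1)
        have hmem : (axisReflection D.axis x.1, x.2) ∈
            prismFacet m (.side ((D.i + D.k - a : ℤ) : ZMod m)) :=
          side_mem D.pos (D.reflection_mem_side hx1) hx.2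
        by_cases hl : l (mu (.side (a : ZMod m))) = 0
        · refine Or.inl ⟨hl, ⟨_, ?_, hin0 a ha0 hak hl⟩, ⟨_, ?_, hin0 a ha0 hak hl⟩⟩
          · rwa [D.shear.up_eq_reflect hx h1, shear_reflect]
          · rwa [D.shear.neg_up_eq_reflect hx h1, shear_reflect]
        · have hl : l (mu (.side (a : ZMod m))) = 1 := Shear.eq_add_one_of_ne hl
          exact Or.inr (Or.inr ⟨hl, h1, _, by rwa [shear_reflect], hin1 a ha0 hak hl⟩)
      · have h0 : D.shear.turn x = 0 := D.amount_eq_zero (D.height_le_lower hak ha1 hx1)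
        by_cases hl : l (mu (.side (a : ZMod m))) = 0
        · refine Or.inl ⟨hl, ⟨_, ?_, hout a hak.le ha1⟩, ⟨_, ?_, hout a hak.le ha1⟩⟩
          · rwa [D.shear.up_eq_self hx h0]
          · rwa [D.shear.neg.up_eq_self hx h0]
        · have hl : l (mu (.side (a : ZMod m))) = 1 := Shear.eq_add_one_of_ne hl
          exact Or.inr (Or.inl ⟨hl, h0, _, hxf, hout a hak.le ha1⟩)
  -- The index reversal a ↦ i + k - a is an involution, so the hypotheses also hold with λ and λ'
  -- exchanged.
  have hback : ∀ a : ℤ, D.i < a → a < D.k → D.i < D.i + D.k - a ∧ D.i + D.k - a < D.k ∧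
      D.i + D.k - (D.i + D.k - a) = a := fun a _ _ => ⟨by omega, by omega, by omega⟩
  refine D.shear.nonempty_homeomorph l _ _ hil hkl D.hasWall_neg D.hasWall (hi ▸ D.hasWall_neg)
    (hk ▸ D.hasWall) (compat lam lam' hcl hfl hc hf hout hin0 hin1) ?_
  rw [← hi, ← hk]
  have hl' : ∀ a : ℤ, D.i < a → a < D.k → l (lam' (.side (a : ZMod m))) =
      l (lam (.side ((D.i + D.k - a : ℤ) : ZMod m))) := by
    intro a h1 h2
    obtain ⟨h3, h4, h5⟩ := hback a h1 h2
    by_cases hl : l (lam (.side ((D.i + D.k - a : ℤ) : ZMod m))) = 0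
    · have := hin0 _ h3 h4 hl
      rw [h5] at this
      rw [this]
    · have := hin1 _ h3 h4 (Shear.eq_add_one_of_ne hl)
      rw [h5] at this
      rw [this, add_assoc, map_add, map_add l (lam _) (lam _), hil, hkl]
      exact add_zero _
  refine compat lam' lam (hc ▸ hcl) (hf ▸ hfl) hc.symm hf.symm (fun a h1 h2 => (hout a h1 h2).symm)
    ?_ ?_
  · intro a h1 h2 hl
    obtain ⟨h3, h4, h5⟩ := hback a h1 h2
    rw [hl' a h1 h2] at hl
    have := hin0 _ h3 h4 hl
    rw [h5] at this
    exact this.symm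
  · intro a h1 h2 hl
    obtain ⟨h3, h4, h5⟩ := hback a h1 h2
    rw [hl' a h1 h2] at hl
    have := hin1 _ h3 h4 hl
    rw [h5] at this
    rw [this, hi, hk, add_assoc (_ + _ + _), add_assoc (lam (.side _)),
      SmallCover.add_add_cancel_two]

end SidePair

/-! ### Rotational symmetry of the prism -/

/-- Rotating the prism. -/
theorem nonempty_homeomorph_of_rotation {m : ℕ} (hm : 0 < m)
    {lam lam' : PrismFacet m → (Fin 3 → ZMod 2)} (r : ℤ)
    (A : (Fin 3 → ZMod 2) ≃ₗ[ZMod 2] (Fin 3 → ZMod 2))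
    (hc : lam' .ceiling = A (lam .ceiling)) (hf : lam' .floor = A (lam .floor))
    (hs : ∀ i, lam' (.side (i + r)) = A (lam (.side i))) :
    Nonempty (PrismSmallCover lam ≃ₜ PrismSmallCover lam') := by
  -- Multiplication by this root of unity rotates the polygon by r steps.
  let w (r : ℤ) : ℂ := circlePoint m r
  have hw : ∀ (r : ℤ) (t : ℝ), w r * circlePoint m t = circlePoint m (t + r) := by
    intro r t
    have : 2 * Real.pi * (t + r) / m = 2 * Real.pi * t / m + 2 * Real.pi * r / m := by ring
    simp only [w, circlePoint, this, Real.cos_add, Real.sin_add]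
    apply Complex.ext <;> simp <;> ring
  have hone : circlePoint m 0 = 1 := by
    apply Complex.ext <;> simp [circlePoint]
  have hinv : ∀ r, w r * w (-r) = 1 := by
    intro r
    have := hw r ((-r : ℤ) : ℝ)
    rw [show (((-r : ℤ) : ℝ) + r) = 0 by push_cast; ring, hone] at this
    exact this
  have hpoly : ∀ r, ∀ q ∈ polygon m, w r * q ∈ polygon m := by
    intro r q hq
    have : LinearMap.mulLeft ℝ (w r) '' polygon m ⊆ polygon m := by
      rw [polygon, LinearMap.image_convexHull]
      refine convexHull_mono ?_
      rintro _ ⟨_, ⟨k, rfl⟩, rfl⟩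
      rw [LinearMap.mulLeft_apply, polygonVertex_eq, hw]
      exact_mod_cast circlePoint_mem_range hm (k + r)
    exact this ⟨q, hq, rfl⟩
  have hside : ∀ (r a : ℤ), ∀ q ∈ polygonSide m a, w r * q ∈ polygonSide m (a + r) := by
    rintro r a _ ⟨s, t, h1, h2, h3, rfl⟩
    refine ⟨s, t, h1, h2, h3, ?_⟩
    rw [mul_add, mul_smul_comm, mul_smul_comm, hw, hw]
    push_cast
    congr 3; ring
  have hedge : ∀ (r : ℤ) (i : ZMod m), ∀ q ∈ polygonEdge m i, w r * q ∈ polygonEdge m (i + r) := by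
    intro r i q hq
    obtain ⟨a, rfl⟩ := ZMod.intCast_surjective i
    rw [← Int.cast_add, polygonEdge_intCast hm]
    rw [polygonEdge_intCast hm] at hq
    exact hside r a q hq
  let φ : ℂ × ℝ ≃ₜ ℂ × ℝ :=
    { toFun := fun x => (w r * x.1, x.2)
      invFun := fun x => (w (-r) * x.1, x.2)
      left_inv := fun x => by
        have := hinv r
        rw [mul_comm] at this
        simp only [← mul_assoc, this, one_mul]
      right_inv := fun x => by simp only [← mul_assoc, hinv, one_mul]
      continuous_toFun := by fun_prop
      continuous_invFun := by fun_prop }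
  have hback : ∀ q : ℂ, w (-r) * (w r * q) = q := fun q =>
    congrArg Prod.fst (φ.left_inv (q, 0))
  let σ : PrismFacet m ≃ PrismFacet m :=
    { toFun := fun f => match f with
        | .ceiling => .ceiling
        | .floor => .floor
        | .side i => .side (i + r)
      invFun := fun f => match f with
        | .ceiling => .ceiling
        | .floor => .floor
        | .side i => .side (i - r)
      left_inv := fun f => by cases f <;> simp
      right_inv := fun f => by cases f <;> simp }
  have hp : ∀ q, w r * q ∈ polygon m ↔ q ∈ polygon m := fun q =>
    ⟨fun h => by rw [← hback q]; exact hpoly _ _ h, hpoly r q⟩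
  have he : ∀ i q, w r * q ∈ polygonEdge m (i + r) ↔ q ∈ polygonEdge m i := by
    refine fun i q => ⟨fun h => ?_, hedge r i q⟩
    have := hedge (-r) _ _ h
    rw [hback] at this
    simpa using this
  refine SmallCover.nonempty_homeomorph_of_symmetry φ σ A ?_ ?_ ?_
  · exact fun x => and_congr (hp _) Iff.rfl
  · rintro (_ | _ | i) x
    · exact and_congr (hp _) Iff.rfl
    · exact and_congr (hp _) Iff.rfl
    · exact and_congr (he _ _) Iff.rfl
  · rintro (_ | _ | i)
    · exact hc
    · exact hf
    · exact hs i

/-! ### Combinatorics of colorings -/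

/-- The color `λ(c) - λ(f)` after normalization. -/
def colorD : Fin 3 → ZMod 2 := ![0, 1, 0]

/-- The coloring with `λ(c) = (1,0,0)`, `λ(f) = (1,1,0)` and given colors of the side faces. -/
def normalColoring {m : ℕ} (a : ZMod m → (Fin 3 → ZMod 2)) : PrismFacet m → (Fin 3 → ZMod 2)
  | .ceiling => ![1, 0, 0]
  | .floor => ![1, 1, 0]
  | .side i => a i

/-- The relation between the colors of adjacent side faces in a normalized coloring. -/
def ColorAdj (p q : Fin 3 → ZMod 2) : Prop :=
  (p = colorD ∧ q 2 = 1) ∨ (p 2 = 1 ∧ q = colorD) ∨ (p 2 = 1 ∧ q = p + colorD)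

/-- The linear form `v₀ + κ v₂`. -/
def sheetForm (k : ZMod 2) : (Fin 3 → ZMod 2) →+ ZMod 2 where
  toFun v := v 0 + k * v 2
  map_zero' := by simp
  map_add' v w := by simp; ring

/-- The linear form `v₂`. -/
def gapForm : (Fin 3 → ZMod 2) →+ ZMod 2 := Pi.evalAddMonoidHom _ 2

theorem ColorAdj.eq_or_left {p q : Fin 3 → ZMod 2} (h : ColorAdj p q) :
    p = colorD ∨ p 2 = 1 := by
  rcases h with h | h | h
  · exact Or.inl h.1
  · exact Or.inr h.1
  · exact Or.inr h.1

theorem ColorAdj.eq_add {p q : Fin 3 → ZMod 2} (h : ColorAdj p q) (hp : p 2 = 1) (hq : q 2 = 1) :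
    q = p + colorD := by
  rcases h with h | h | h
  · rw [h.1] at hp; exact absurd hp (by decide)
  · rw [h.2] at hq; exact absurd hq (by decide)
  · exact h.2

theorem eq_or_eq_add_colorD {p q : Fin 3 → ZMod 2} (h0 : q 0 = p 0) (h2 : q 2 = p 2) :
    q = p ∨ q = p + colorD := by
  have key : ∀ x y : ZMod 2, y = x ∨ y = x + 1 := by decide
  rcases key (p 1) (q 1) with h | h
  · left; ext j; fin_cases j <;> assumption
  · right; ext j; fin_cases j <;> simp [colorD, h0, h, h2]

/-- Two colorings whose colors agree up to multiples of `λ(c) - λ(f)` have homeomorphic small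
covers. -/
theorem nonempty_homeomorph_of_eq_mod {m : ℕ} (hm : 0 < m) {a a' : ZMod m → (Fin 3 → ZMod 2)}
    (ha : ∀ i, ColorAdj (a i) (a (i + 1))) (ha' : ∀ i, ColorAdj (a' i) (a' (i + 1)))
    (h0 : ∀ i, a' i 0 = a i 0) (h2 : ∀ i, a' i 2 = a i 2) :
    Nonempty (PrismSmallCover (normalColoring a) ≃ₜ PrismSmallCover (normalColoring a')) := by
  -- One vertical rotation: `sheetForm k` is 1 on ceiling and floor, 0 on D, and v 0 + k on a gap
  -- color v. So it affects exactly the gap colors with one prescribed first coordinate.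
  have key : ∀ (k : ZMod 2) (b b' : ZMod m → (Fin 3 → ZMod 2)),
      (∀ i, b i 0 = a i 0) → (∀ i, b i 2 = a i 2) →
      (∀ i, sheetForm k (a i) = 1 → b i = a i ∧ b' i = a' i) →
      (∀ i, sheetForm k (a i) ≠ 1 → b' i = b i) →
      Nonempty (PrismSmallCover (normalColoring b) ≃ₜ PrismSmallCover (normalColoring b')) := by
    intro k b b' hb0 hb2 hb hb'
    have hform : ∀ i, sheetForm k (b i) = sheetForm k (a i) := by
      intro i
      change b i 0 + k * b i 2 = a i 0 + k * a i 2
      rw [hb0, hb2]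
    have hgap : ∀ i, sheetForm k (a i) = 1 → a i 2 = 1 := by
      intro i hi
      refine (ha i).eq_or_left.resolve_left fun h => ?_
      rw [h] at hi
      change (0 : ZMod 2) + k * 0 = 1 at hi
      simp at hi
    refine nonempty_homeomorph_of_vertical hm (sheetForm k) ?_ ?_ rfl rfl ?_ ?_
    · change (1 : ZMod 2) + k * 0 = 1
      simp
    · change (1 : ZMod 2) + k * 0 = 1
      simp
    · intro i
      change b' i = b i ∨ sheetForm k (b i) = 1 ∧ b' i = b i + ![1, 1, 0] + ![1, 0, 0]
      have e : b i + ![1, 1, 0] + ![1, 0, 0] = b i + colorD := by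
        rw [add_assoc]; congr 1; decide
      rw [e, hform]
      by_cases hi : sheetForm k (a i) = 1
      · obtain ⟨h3, h4⟩ := hb i hi
        rw [h3, h4]
        rcases eq_or_eq_add_colorD (h0 i) (h2 i) with h | h
        · exact Or.inl h
        · exact Or.inr ⟨hi, h⟩
      · exact Or.inl (hb' i hi)
    · intro i hi hi'
      change sheetForm k (b i) = 1 at hi
      change sheetForm k (b (i + 1)) = 1 at hi'
      change b' i = b i ↔ b' (i + 1) = b (i + 1)
      rw [hform] at hi hi'
      obtain ⟨h3, h4⟩ := hb i hi
      obtain ⟨h5, h6⟩ := hb _ hi'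
      -- Adjacent gap colors differ by D in both colorings, so they change together.
      have e1 := (ha i).eq_add (hgap _ hi) (hgap _ hi')
      have e2 := (ha' i).eq_add ((h2 i).trans (hgap _ hi)) ((h2 _).trans (hgap _ hi'))
      rw [h3, h4, h5, h6, e1, e2, add_left_inj]
  -- The intermediate coloring: first the gap colors with first coordinate 0 are adjusted (k = 1),
  -- then those with first coordinate 1 (k = 0).
  let b : ZMod m → (Fin 3 → ZMod 2) := fun i => if sheetForm 1 (a i) = 1 then a' i else a i
  have hb0 : ∀ i, b i 0 = a i 0 := by
    intro i; simp only [b]; split_ifs; exacts [h0 i, rfl]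
  have hb2 : ∀ i, b i 2 = a i 2 := by
    intro i; simp only [b]; split_ifs; exacts [h2 i, rfl]
  obtain ⟨e1⟩ := key 1 a b (fun _ => rfl) (fun _ => rfl) (fun i hi => ⟨rfl, if_pos hi⟩)
    (fun i hi => if_neg hi)
  obtain ⟨e2⟩ := key 0 b a' hb0 hb2 (by
    intro i hi
    refine ⟨if_neg ?_, rfl⟩
    have hi0 : a i 0 = 1 := by
      change a i 0 + 0 * a i 2 = 1 at hi
      simpa using hi
    change a i 0 + 1 * a i 2 ≠ 1
    rcases (ha i).eq_or_left with h | h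
    · rw [h] at hi0; exact absurd hi0 (by decide)
    · rw [hi0, h]; decide) (by
    intro i hi
    change a i 0 + 0 * a i 2 ≠ 1 at hi
    simp only [b]
    split_ifs with h
    · rfl
    change a i 0 + 1 * a i 2 ≠ 1 at h
    rcases (ha i).eq_or_left with h' | h'
    · rcases (ha' i).eq_or_left with h'' | h''
      · rw [h', h'']
      · rw [h2, h'] at h''; exact absurd h'' (by decide)
    · rw [h'] at h
      have : a i 0 = 0 ∨ a i 0 = 1 := by
        generalize a i 0 = x; revert x; decide
      rcases this with h3 | h3 <;> simp [h3] at h hi)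
  exact ⟨e1.trans e2⟩

/-! ### Rotations and reversals for lists of side colors -/

/-- The coloring whose side faces have the colors in a list. -/
def listColoring (m : ℕ) (s : List (Fin 3 → ZMod 2)) : PrismFacet m → (Fin 3 → ZMod 2) :=
  normalColoring fun i => s.getD i.val 0

theorem listColoring_side {m : ℕ} (s : List (Fin 3 → ZMod 2)) {j : ℕ} (hj : j < m) :
    listColoring m s (.side (j : ZMod m)) = s.getD j 0 := by
  change s.getD (j : ZMod m).val 0 = _
  rw [ZMod.val_natCast_of_lt hj]

/-- The automorphism of `ℤ₂³` fixing `(1,0,0)` and `(0,1,0)` that adds `u` to `(0,0,1)`. -/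
def gapTranslation (u : Fin 3 → ZMod 2) (hu : u 2 = 0) :
    (Fin 3 → ZMod 2) ≃ₗ[ZMod 2] (Fin 3 → ZMod 2) where
  toFun v := v + v 2 • u
  invFun v := v + v 2 • u
  map_add' v w := by simp only [Pi.add_apply, add_smul]; abel
  map_smul' c v := by simp only [Pi.smul_apply, smul_add, smul_smul, RingHom.id_apply, smul_eq_mul]
  left_inv v := by
    simp only [Pi.add_apply, Pi.smul_apply, hu, smul_zero, add_zero]
    exact SmallCover.add_add_cancel_two _ _
  right_inv v := by
    simp only [Pi.add_apply, Pi.smul_apply, hu, smul_zero, add_zero]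
    exact SmallCover.add_add_cancel_two _ _

theorem gapTranslation_apply (u : Fin 3 → ZMod 2) (hu : u 2 = 0) (v : Fin 3 → ZMod 2) :
    gapTranslation u hu v = v + v 2 • u := rfl

/-- Rotation by the length of Y puts Y in front of X. The translation by u fixes the colors of
ceiling and floor; it will be used to restore the starting color of a walk. -/
theorem nonempty_homeomorph_of_append_comm {m : ℕ} (hm : 0 < m) (X Y : List (Fin 3 → ZMod 2))
    (hlen : X.length + Y.length = m) (u : Fin 3 → ZMod 2) (hu : u 2 = 0) :
    Nonempty (PrismSmallCover (listColoring m (X ++ Y)) ≃ₜ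
      PrismSmallCover (listColoring m ((Y ++ X).map (gapTranslation u hu)))) := by
  have : NeZero m := ⟨hm.ne'⟩
  refine nonempty_homeomorph_of_rotation hm (Y.length : ℤ) (gapTranslation u hu) ?_ ?_ ?_
  · change ![1, 0, 0] = _
    rw [gapTranslation_apply]
    change _ = _ + (0 : ZMod 2) • u
    rw [zero_smul, add_zero]; rfl
  · change ![1, 1, 0] = _
    rw [gapTranslation_apply]
    change _ = _ + (0 : ZMod 2) • u
    rw [zero_smul, add_zero]; rfl
  · intro i
    obtain ⟨j, hj, rfl⟩ : ∃ j < m, ((j : ℕ) : ZMod m) = i :=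
      ⟨i.val, i.val_lt, ZMod.natCast_zmod_val i⟩
    rw [listColoring_side _ hj, Int.cast_natCast]
    have hA0 : gapTranslation u hu 0 = 0 := map_zero _
    rcases lt_or_ge j X.length with h | h
    · rw [← Nat.cast_add, listColoring_side _ (by omega), List.getD_eq_getElem?_getD,
        List.getD_eq_getElem?_getD, List.getElem?_map, List.getElem?_append_left h,
        List.getElem?_append_right (by omega), Nat.add_sub_cancel]
      rw [List.getElem?_eq_getElem h]; rfl
    -- Entries of Y wrap around the end of the list.
    · have e : (j : ZMod m) + (Y.length : ℕ) = ((j - X.length : ℕ) : ZMod m) := by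
        rw [← Nat.cast_add, show j + Y.length = (j - X.length) + m by omega]
        simp
      rw [e, listColoring_side _ (by omega), List.getD_eq_getElem?_getD,
        List.getD_eq_getElem?_getD, List.getElem?_map, List.getElem?_append_right h,
        List.getElem?_append_left (by omega)]
      rw [List.getElem?_eq_getElem (by omega)]; rfl

/-- Reversing the colors between two entries `p` and `q`. -/
theorem nonempty_homeomorph_of_reverse {m : ℕ} (A X B : List (Fin 3 → ZMod 2))
    (p q : Fin 3 → ZMod 2) (hp : p 2 = 1) (hq : q 2 = 1)
    (hlen : A.length + X.length + B.length + 2 = m) :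
    Nonempty (PrismSmallCover (listColoring m (A ++ p :: (X ++ q :: B))) ≃ₜ
      PrismSmallCover (listColoring m (A ++ p ::
        ((X.reverse.map fun v => if v 2 = 0 then v else v + p + q) ++ q :: B)))) := by
  set X' := X.reverse.map fun v => if v 2 = 0 then v else v + p + q with hX'
  have hX'len : X'.length = X.length := by simp [hX']
  -- The positions of p and q; `gapForm` is 1 on both and vanishes on ceiling and floor.
  let D : SidePair m := ⟨A.length, A.length + X.length + 1, by omega, by omega⟩
  have hDi : ((D.i : ℤ) : ZMod m) = ((A.length : ℕ) : ZMod m) := by simp [D]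
  have hDk : ((D.k : ℤ) : ZMod m) = ((A.length + X.length + 1 : ℕ) : ZMod m) := by simp [D]
  have gi : ∀ Z : List (Fin 3 → ZMod 2),
      listColoring m (A ++ p :: (Z ++ q :: B)) (.side (D.i : ZMod m)) = p := by
    intro Z
    rw [hDi, listColoring_side _ (by omega), List.getD_eq_getElem?_getD,
      List.getElem?_append_right le_rfl]
    simp
  have gk : ∀ Z : List (Fin 3 → ZMod 2), Z.length = X.length →
      listColoring m (A ++ p :: (Z ++ q :: B)) (.side (D.k : ZMod m)) = q := by
    intro Z hZ
    rw [hDk, listColoring_side _ (by omega), List.getD_eq_getElem?_getD,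
      List.getElem?_append_right (by omega),
      show A.length + X.length + 1 - A.length = X.length + 1 by omega, List.getElem?_cons_succ,
      List.getElem?_append_right hZ.le, hZ]
    simp
  have gX : ∀ Z : List (Fin 3 → ZMod 2), Z.length = X.length → ∀ j (hj : j < Z.length),
      listColoring m (A ++ p :: (Z ++ q :: B)) (.side ((A.length + 1 + j : ℕ) : ZMod m)) =
        Z[j] := by
    intro Z hZ j hj
    rw [listColoring_side _ (by omega), List.getD_eq_getElem?_getD,
      List.getElem?_append_right (by omega),
      show A.length + 1 + j - A.length = j + 1 by omega, List.getElem?_cons_succ,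
      List.getElem?_append_left hj, List.getElem?_eq_getElem hj]
    rfl
  have gin : ∀ a : ℤ, D.i < a → a < D.k → ∃ v,
      listColoring m (A ++ p :: (X ++ q :: B)) (.side (a : ZMod m)) = v ∧
      listColoring m (A ++ p :: (X' ++ q :: B)) (.side ((D.i + D.k - a : ℤ) : ZMod m)) =
        if v 2 = 0 then v else v + p + q := by
    intro a h1 h2
    simp only [D] at h1 h2
    obtain ⟨j, rfl⟩ : ∃ j : ℕ, a = ((A.length + 1 + j : ℕ) : ℤ) :=
      ⟨(a - A.length - 1).toNat, by omega⟩
    have hj : j < X.length := by push_cast at h2; omega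
    refine ⟨X[j], ?_, ?_⟩
    · rw [Int.cast_natCast, gX X rfl j hj]
    · have : (D.i + D.k - ((A.length + 1 + j : ℕ) : ℤ)) =
          ((A.length + 1 + (X.length - 1 - j) : ℕ) : ℤ) := by
        simp only [D]; omega
      rw [this, Int.cast_natCast, gX X' hX'len _ (by omega)]
      have hrev : X.reverse[X.length - 1 - j]'(by simp; omega) = X[j] := by
        rw [List.getElem_reverse]; congr 1; omega
      simp only [hX', List.getElem_map, hrev]
  refine D.nonempty_homeomorph gapForm rfl rfl rfl rfl ?_ ?_ ?_ ?_ ?_ ?_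
  · rw [gi]; exact hp
  · rw [gk _ rfl]; exact hq
  · rw [gi, gi]
  · intro a h1 h2
    simp only [D] at h1 h2
    -- The complementary arc consists of q and B, followed by A after wrapping around.
    rcases lt_or_ge a m with h | h
    · obtain ⟨j, rfl⟩ : ∃ j : ℕ, a = ((A.length + X.length + 1 + j : ℕ) : ℤ) :=
        ⟨(a - (A.length + X.length + 1)).toNat, by omega⟩
      rw [Int.cast_natCast, listColoring_side _ (by omega), listColoring_side _ (by omega),
        List.getD_eq_getElem?_getD, List.getD_eq_getElem?_getD,
        List.getElem?_append_right (by omega), List.getElem?_append_right (by omega),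
        show A.length + X.length + 1 + j - A.length = X.length + j + 1 by omega,
        List.getElem?_cons_succ, List.getElem?_cons_succ, List.getElem?_append_right (by omega),
        List.getElem?_append_right (by omega), hX'len]
    · obtain ⟨j, rfl⟩ : ∃ j : ℕ, a = (j : ℤ) + m := ⟨(a - m).toNat, by omega⟩
      have : (((j : ℤ) + m : ℤ) : ZMod m) = ((j : ℕ) : ZMod m) := by simp
      rw [this, listColoring_side _ (by omega), listColoring_side _ (by omega),
        List.getD_eq_getElem?_getD, List.getD_eq_getElem?_getD,
        List.getElem?_append_left (by omega), List.getElem?_append_left (by omega)]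
  · intro a h1 h2 hl
    obtain ⟨v, e1, e2⟩ := gin a h1 h2
    rw [e1] at hl ⊢
    rw [e2]
    exact if_pos hl
  · intro a h1 h2 hl
    obtain ⟨v, e1, e2⟩ := gin a h1 h2
    rw [e1] at hl ⊢
    rw [e2, gi, gk _ rfl]
    refine if_neg fun h => ?_
    change v 2 = 1 at hl
    rw [h] at hl
    exact absurd hl (by decide)

/-! ### Closed walks and permutations of their letters -/

/-- The colors of a piece of the walk around the prism, starting with the color `a`: each letter
`(b, g)` contributes the current color, followed by `λ(c) - λ(f)` if `b` holds, and then changes the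
current color by `g`. -/
def walk : (Fin 3 → ZMod 2) → List (Bool × (Fin 3 → ZMod 2)) → List (Fin 3 → ZMod 2)
  | _, [] => []
  | a, x :: L => (a :: if x.1 then [colorD] else []) ++ walk (a + x.2) L

/-- The total change of color. -/
def walkTotal (L : List (Bool × (Fin 3 → ZMod 2))) : Fin 3 → ZMod 2 := (L.map Prod.snd).sum

/-- The letters that occur in colorings. -/
def IsLetter (x : Bool × (Fin 3 → ZMod 2)) : Prop := x.2 2 = 0 ∧ (x.1 = false → x.2 = colorD)

theorem walkTotal_cons (x : Bool × (Fin 3 → ZMod 2)) (L : List (Bool × (Fin 3 → ZMod 2))) :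
    walkTotal (x :: L) = x.2 + walkTotal L := rfl

theorem walkTotal_append (L L' : List (Bool × (Fin 3 → ZMod 2))) :
    walkTotal (L ++ L') = walkTotal L + walkTotal L' := by
  simp [walkTotal]

theorem walk_append (L L' : List (Bool × (Fin 3 → ZMod 2))) (a : Fin 3 → ZMod 2) :
    walk a (L ++ L') = walk a L ++ walk (a + walkTotal L) L' := by
  induction L generalizing a with
  | nil => simp [walk, walkTotal]
  | cons x L ih => simp only [List.cons_append, walk, ih, walkTotal_cons, add_assoc,
      List.append_assoc]

theorem length_walk (L : List (Bool × (Fin 3 → ZMod 2))) (a : Fin 3 → ZMod 2) :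
    (walk a L).length = L.length + L.countP Prod.fst := by
  induction L generalizing a with
  | nil => rfl
  | cons x L ih =>
    rcases x with ⟨_ | _, g⟩
    · simp [walk, ih]; omega
    · simp [walk, ih]; omega

theorem walkTotal_apply_two {L : List (Bool × (Fin 3 → ZMod 2))} (hL : ∀ x ∈ L, IsLetter x) :
    walkTotal L 2 = 0 := by
  induction L with
  | nil => rfl
  | cons x L ih =>
    rw [List.forall_mem_cons] at hL
    rw [walkTotal_cons, Pi.add_apply, ih hL.2, hL.1.1, add_zero]

/-- The translation shifts every gap color by u and fixes D; the letters record only differences of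
gap colors and stay the same. -/
theorem map_gapTranslation_walk (u : Fin 3 → ZMod 2) (hu : u 2 = 0)
    {L : List (Bool × (Fin 3 → ZMod 2))} (hL : ∀ x ∈ L, IsLetter x) (a : Fin 3 → ZMod 2)
    (ha : a 2 = 1) : (walk a L).map (gapTranslation u hu) = walk (a + u) L := by
  induction L generalizing a with
  | nil => rfl
  | cons x L ih =>
    rw [List.forall_mem_cons] at hL
    have h1 : gapTranslation u hu a = a + u := by rw [gapTranslation_apply, ha, one_smul]
    have h2 : gapTranslation u hu colorD = colorD := by
      rw [gapTranslation_apply]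
      change _ + (0 : ZMod 2) • u = _
      rw [zero_smul, add_zero]
    have h3 := ih hL.2 (a + x.2) (by rw [Pi.add_apply, ha, hL.1.1, add_zero])
    rw [add_right_comm] at h3
    rcases x with ⟨_ | _, g⟩
    · simp [walk, h1, h3]
    · simp [walk, h1, h2, h3]

/-- The final color is appended so that the induction, and later the closing up of the walk, also
sees the adjacency after the last face. -/
theorem isChain_walk {L : List (Bool × (Fin 3 → ZMod 2))} (hL : ∀ x ∈ L, IsLetter x)
    (a : Fin 3 → ZMod 2) (ha : a 2 = 1) :
    ∃ T, walk a L ++ [a + walkTotal L] = a :: T ∧ List.IsChain ColorAdj (a :: T) := by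
  induction L generalizing a with
  | nil => exact ⟨[], by simp [walk, walkTotal], List.isChain_singleton _⟩
  | cons x L ih =>
    rw [List.forall_mem_cons] at hL
    have ha' : (a + x.2) 2 = 1 := by rw [Pi.add_apply, ha, hL.1.1, add_zero]
    obtain ⟨T, hT, hc⟩ := ih hL.2 (a + x.2) ha'
    rw [add_assoc] at hT
    rcases x with ⟨_ | _, g⟩
    · refine ⟨(a + g) :: T, by simpa [walk, walkTotal_cons] using hT, ?_⟩
      rw [List.isChain_cons_cons]
      exact ⟨Or.inr (Or.inr ⟨ha, congrArg (a + ·) (hL.1.2 rfl)⟩), hc⟩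
    · refine ⟨colorD :: (a + g) :: T, by simpa [walk, walkTotal_cons] using hT, ?_⟩
      rw [List.isChain_cons_cons, List.isChain_cons_cons]
      exact ⟨Or.inr (Or.inl ⟨ha, rfl⟩), Or.inl ⟨rfl, ha'⟩, hc⟩

theorem colorAdj_walk {m : ℕ} (hm : 1 < m) {L : List (Bool × (Fin 3 → ZMod 2))}
    (hL : ∀ x ∈ L, IsLetter x) (h0 : walkTotal L = 0) (a : Fin 3 → ZMod 2) (ha : a 2 = 1)
    (hlen : L.length + L.countP Prod.fst = m) (i : ZMod m) :
    ColorAdj ((walk a L).getD i.val 0) ((walk a L).getD (i + 1).val 0) := by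
  have : NeZero m := ⟨by omega⟩
  have : Fact (1 < m) := ⟨hm⟩
  obtain ⟨T, hT, hc⟩ := isChain_walk hL a ha
  rw [← hT, h0, add_zero, List.isChain_iff_getElem] at hc
  have hlw := length_walk L a
  have hi := i.val_lt
  have h1 := hc i.val (by simp; omega)
  rw [List.getElem_append_left (by omega)] at h1
  rw [List.getD_eq_getElem _ _ (by omega)]
  convert h1 using 1
  rw [ZMod.val_add, ZMod.val_one]
  -- For the last face the successor is the first one; its color is the appended final color,
  -- because the total change is zero.
  rcases (by omega : i.val + 1 < m ∨ i.val + 1 = m) with h | h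
  · rw [Nat.mod_eq_of_lt h, List.getD_eq_getElem _ _ (by omega),
      List.getElem_append_left (by omega)]
  · rw [List.getElem_append_right (by omega)]
    simp only [h, Nat.mod_self, List.getElem_singleton]
    cases L with
    | nil => simp at hlen; omega
    | cons x L => simp [walk]

/-- The colorings have homeomorphic small covers. -/
def HomeomorphicCovers {m : ℕ} (lam lam' : PrismFacet m → (Fin 3 → ZMod 2)) : Prop :=
  Nonempty (PrismSmallCover lam ≃ₜ PrismSmallCover lam')

section Moves

variable {m : ℕ} {a : Fin 3 → ZMod 2}

/-- After the rotation the walk starts at a + `walkTotal L`; translating by `walkTotal L` brings the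
start back to a. The two totals agree since their sum is zero. -/
theorem nonempty_homeomorph_walk_append_comm (hm : 0 < m) (ha : a 2 = 1)
    (L L' : List (Bool × (Fin 3 → ZMod 2))) (hL : ∀ x ∈ L, IsLetter x) (hL' : ∀ x ∈ L', IsLetter x)
    (h0 : walkTotal (L ++ L') = 0)
    (hlen : (L ++ L').length + (L ++ L').countP Prod.fst = m) :
    Nonempty (PrismSmallCover (listColoring m (walk a (L ++ L'))) ≃ₜ
      PrismSmallCover (listColoring m (walk a (L' ++ L)))) := by
  have hu := walkTotal_apply_two hL
  have h1 := nonempty_homeomorph_of_append_comm hm (walk a L) (walk (a + walkTotal L) L')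
    (by rw [length_walk, length_walk, ← hlen, List.length_append, List.countP_append]; omega)
    (walkTotal L) hu
  have he : walkTotal L' = walkTotal L := by
    rw [walkTotal_append] at h0
    have := SmallCover.add_add_cancel_two (walkTotal L) (walkTotal L')
    rw [h0, zero_add] at this
    exact this
  rw [List.map_append, map_gapTranslation_walk _ _ hL _ ha, map_gapTranslation_walk _ _ hL' _
    (by rw [Pi.add_apply, ha, hu, add_zero]), SmallCover.add_add_cancel_two, ← walk_append] at h1
  rwa [walk_append L' L, he]

/-- Reverse the stretch between the gap colors p and p + x.2 + y.2. The only gap color inside, p +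
x.2, becomes p + y.2, and the possible D's before and after it trade places. The letter z guarantees
that a face of color p + x.2 + y.2 follows in the list. -/
theorem nonempty_homeomorph_walk_swap (ha : a 2 = 1)
    (P S : List (Bool × (Fin 3 → ZMod 2))) (x y z : Bool × (Fin 3 → ZMod 2))
    (hP : ∀ x ∈ P, IsLetter x) (hx : IsLetter x) (hy : IsLetter y)
    (hlen : (P ++ x :: y :: z :: S).length + (P ++ x :: y :: z :: S).countP Prod.fst = m) :
    Nonempty (PrismSmallCover (listColoring m (walk a (P ++ x :: y :: z :: S))) ≃ₜ
      PrismSmallCover (listColoring m (walk a (P ++ y :: x :: z :: S)))) := by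
  let d (x : Bool × (Fin 3 → ZMod 2)) : List (Fin 3 → ZMod 2) := if x.1 then [colorD] else []
  set p := a + walkTotal P with hp
  have hp2 : p 2 = 1 := by rw [hp, Pi.add_apply, walkTotal_apply_two hP, ha, add_zero]
  have e1 : walk a (P ++ x :: y :: z :: S) = walk a P ++ p :: ((d x ++ (p + x.2) :: d y) ++
      (p + x.2 + y.2) :: (d z ++ walk (p + x.2 + y.2 + z.2) S)) := by
    rw [walk_append]; simp [walk, d, hp]
  have e2 : walk a (P ++ y :: x :: z :: S) = walk a P ++ p :: ((d y ++ (p + y.2) :: d x) ++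
      (p + x.2 + y.2) :: (d z ++ walk (p + x.2 + y.2 + z.2) S)) := by
    rw [walk_append, add_right_comm p x.2 y.2]; simp [walk, d, hp]
  have hlen' := length_walk (P ++ x :: y :: z :: S) a
  rw [hlen, e1] at hlen'
  have h := nonempty_homeomorph_of_reverse (m := m) (walk a P) (d x ++ (p + x.2) :: d y)
    (d z ++ walk (p + x.2 + y.2 + z.2) S) p (p + x.2 + y.2) hp2
    (by rw [Pi.add_apply, Pi.add_apply, hp2, hx.1, hy.1]; rfl)
    (by rw [← hlen']; simp only [List.length_append, List.length_cons]; omega)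
  have hd : ∀ w, (d w).reverse.map (fun v => if v 2 = 0 then v else v + p + (p + x.2 + y.2)) =
      d w := by
    intro w
    simp only [d]
    split_ifs
    · simp [colorD]
    · rfl
  have hg : (p + x.2) 2 ≠ 0 := by
    rw [Pi.add_apply, hp2, hx.1]; decide
  have hg' : p + x.2 + p + (p + x.2 + y.2) = p + y.2 := by
    have h1 := SmallCover.add_add_cancel_two (p + y.2) (p + x.2)
    rw [← h1]; abel
  have e3 : (d x ++ (p + x.2) :: d y).reverse.map
      (fun v => if v 2 = 0 then v else v + p + (p + x.2 + y.2)) = d y ++ (p + y.2) :: d x := by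
    rw [List.reverse_append, List.reverse_cons, List.map_append, List.map_append, hd, hd,
      List.map_singleton, if_neg hg, hg', List.append_assoc]
    rfl
  rw [e3, ← e2, ← e1] at h
  exact h

/-- Induction over transpositions. The fixed letter z after the permuted block ensures that every
transposed pair has a successor, as the swap demands. -/
theorem nonempty_homeomorph_walk_perm_append (ha : a 2 = 1)
    {L L' : List (Bool × (Fin 3 → ZMod 2))} (hp : L.Perm L') (z : Bool × (Fin 3 → ZMod 2)) :
    ∀ P S : List (Bool × (Fin 3 → ZMod 2)), (∀ x ∈ P, IsLetter x) → (∀ x ∈ L, IsLetter x) →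
      (P ++ L ++ z :: S).length + (P ++ L ++ z :: S).countP Prod.fst = m →
      HomeomorphicCovers (listColoring m (walk a (P ++ L ++ z :: S)))
        (listColoring m (walk a (P ++ L' ++ z :: S))) := by
  induction hp with
  | nil => exact fun P S _ _ _ => ⟨Homeomorph.refl _⟩
  | cons x _ ih =>
    intro P S hP hL hlen
    rw [List.forall_mem_cons] at hL
    have := ih (P ++ [x]) S (by
      intro y hy
      rcases List.mem_append.1 hy with h | h
      · exact hP y h
      · rw [List.mem_singleton.1 h]; exact hL.1) hL.2
    simp only [List.append_assoc, List.cons_append, List.nil_append] at this hlen ⊢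
    exact this hlen
  | swap x y l =>
    intro P S hP hL hlen
    rw [List.forall_mem_cons, List.forall_mem_cons] at hL
    obtain ⟨z', S', h⟩ : ∃ z' S', l ++ z :: S = z' :: S' := by
      cases l with
      | nil => exact ⟨_, _, rfl⟩
      | cons w l => exact ⟨_, _, rfl⟩
    simp only [List.append_assoc, List.cons_append, h] at hlen ⊢
    exact nonempty_homeomorph_walk_swap ha P S' y x z' hP hL.1 hL.2.1 hlen
  | trans h1 _ ih1 ih2 =>
    intro P S hP hL hlen
    obtain ⟨e1⟩ := ih1 P S hP hL hlen
    have hp' := (h1.append_left P).append_right (z :: S)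
    obtain ⟨e2⟩ := ih2 P S hP (fun x hx => hL x (h1.mem_iff.2 hx))
      (by rw [← hlen, hp'.length_eq, hp'.countP_eq])
    exact ⟨e1.trans e2⟩

/-- Permuting the letters of a closed walk does not change the small cover. -/
theorem nonempty_homeomorph_walk_perm (hm : 0 < m) (ha : a 2 = 1)
    {L L' : List (Bool × (Fin 3 → ZMod 2))} (hp : L.Perm L') (hL : ∀ x ∈ L, IsLetter x)
    (h0 : walkTotal L = 0) (hlen : L.length + L.countP Prod.fst = m) :
    Nonempty (PrismSmallCover (listColoring m (walk a L)) ≃ₜ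
      PrismSmallCover (listColoring m (walk a L'))) := by
  rcases List.eq_nil_or_concat' L with rfl | ⟨L₀, l, rfl⟩
  · rw [hp.nil_eq]; exact ⟨Homeomorph.refl _⟩
  -- A cyclic shift of L' moves the last letter of L to its end; that letter can then stay fixed
  -- while the others are permuted.
  obtain ⟨A, B, rfl⟩ := List.append_of_mem (hp.mem_iff.1 (by simp : l ∈ L₀ ++ [l]))
  have hp' : (L₀ ++ [l]).Perm (B ++ (A ++ [l])) := by
    refine hp.trans ?_
    rw [show A ++ l :: B = (A ++ [l]) ++ B by simp]
    exact List.perm_append_comm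
  have hp0 : L₀.Perm (B ++ A) := by
    rwa [← List.append_assoc, List.perm_append_right_iff] at hp'
  obtain ⟨e1⟩ := nonempty_homeomorph_walk_perm_append ha hp0 l [] [] (by simp)
    (fun x hx => hL x (List.mem_append_left _ hx)) hlen
  have hmem : ∀ x ∈ B ++ (A ++ [l]), IsLetter x := fun x hx => hL x (hp'.mem_iff.2 hx)
  obtain ⟨e2⟩ := nonempty_homeomorph_walk_append_comm hm ha B (A ++ [l])
    (fun x hx => hmem x (List.mem_append_left _ hx))
    (fun x hx => hmem x (List.mem_append_right _ hx))
    (by rw [← h0]; exact ((hp'.map _).sum_eq).symm)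
    (by rw [← hp'.length_eq, ← hp'.countP_eq, hlen])
  rw [List.nil_append, List.nil_append, List.append_assoc] at e1
  rw [show (A ++ [l]) ++ B = A ++ l :: B by simp] at e2
  exact ⟨e1.trans e2⟩

theorem walk_getD_of_forall₂ {L L' : List (Bool × (Fin 3 → ZMod 2))}
    (h : List.Forall₂ (fun x y => x.1 = y.1 ∧ x.2 0 = y.2 0 ∧ x.2 2 = y.2 2) L L')
    (b b' : Fin 3 → ZMod 2) (h0 : b 0 = b' 0) (h2 : b 2 = b' 2) (j : ℕ) :
    (walk b L).getD j 0 0 = (walk b' L').getD j 0 0 ∧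
      (walk b L).getD j 0 2 = (walk b' L').getD j 0 2 := by
  induction h generalizing b b' j with
  | nil => exact ⟨rfl, rfl⟩
  | @cons x y L L' hxy _ ih =>
    have ih' := ih (b + x.2) (b' + y.2) (by simp [h0, hxy.2.1]) (by simp [h2, hxy.2.2])
    rcases x with ⟨_ | _, g⟩ <;> rcases y with ⟨_ | _, g'⟩ <;> simp only [reduceCtorEq] at hxy
    · rcases j with _ | j
      · exact ⟨h0, h2⟩
      · exact ih' j
    · exact absurd hxy.1 (by simp)
    · exact absurd hxy.1 (by simp)
    · rcases j with _ | _ | j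
      · exact ⟨h0, h2⟩
      · exact ⟨rfl, rfl⟩
      · exact ih' j

/-- The small cover of a closed walk depends only on the numbers of letters of each kind. -/
theorem nonempty_homeomorph_walk (hm : 1 < m) (ha : a 2 = 1)
    {L L' : List (Bool × (Fin 3 → ZMod 2))} (hL : ∀ x ∈ L, IsLetter x) (hL' : ∀ x ∈ L', IsLetter x)
    (h0 : walkTotal L = 0) (h0' : walkTotal L' = 0)
    (hlen : L.length + L.countP Prod.fst = m) (hlen' : L'.length + L'.countP Prod.fst = m)
    (hd : L.countP Prod.fst = L'.countP Prod.fst)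
    (hz : L.countP (fun x => x.2 0 = 1) = L'.countP (fun x => x.2 0 = 1)) :
    Nonempty (PrismSmallCover (listColoring m (walk a L)) ≃ₜ
      PrismSmallCover (listColoring m (walk a L'))) := by
  -- The kind remembers a letter modulo D. A letter without D has step D, so (false, 1) never
  -- occurs, and the other three counts follow from the length and the two given counts.
  let kind (x : Bool × (Fin 3 → ZMod 2)) : Bool × ZMod 2 := (x.1, x.2 0)
  have hkind : ∀ L : List (Bool × (Fin 3 → ZMod 2)), (∀ x ∈ L, IsLetter x) →
      (L.map kind).count (false, 1) = 0 ∧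
      (L.map kind).count (true, 1) = L.countP (fun x => x.2 0 = 1) ∧
      (L.map kind).count (true, 0) + L.countP (fun x => x.2 0 = 1) = L.countP Prod.fst ∧
      (L.map kind).count (false, 0) + L.countP Prod.fst = L.length := by
    intro L hL
    induction L with
    | nil => exact ⟨rfl, rfl, rfl, rfl⟩
    | cons x L ih =>
      rw [List.forall_mem_cons] at hL
      obtain ⟨i1, i2, i3, i4⟩ := ih hL.2
      have hx := hL.1.2
      rcases x with ⟨_ | _, g⟩
      · have hg : g 0 = 0 := by rw [show g = colorD from hx rfl]; rfl
        simp [kind, hg, i1, i2, i3, ← i4]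
        omega
      · have hg : g 0 = 0 ∨ g 0 = 1 := by
          generalize g 0 = t; revert t; decide
        rcases hg with hg | hg
        · simp [kind, hg, i1, i2, ← i3, ← i4]
          omega
        · simp [kind, hg, i1, i2, ← i3, ← i4]
          omega
  have hperm : (L.map kind).Perm (L'.map kind) := by
    rw [List.perm_iff_count]
    obtain ⟨i1, i2, i3, i4⟩ := hkind L hL
    obtain ⟨j1, j2, j3, j4⟩ := hkind L' hL'
    rintro ⟨_ | _, c⟩ <;> obtain rfl | rfl : c = 0 ∨ c = 1 := by revert c; decide
    all_goals omega
  -- Rearrange L so that its kinds match those of L' letter by letter; the two walks then agree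
  -- modulo D.
  obtain ⟨L₁, h1, h2⟩ : ∃ L₁, L.Perm L₁ ∧ List.Forall₂ (fun x y => kind x = kind y) L₁ L' := by
    have h1 : List.Forall₂ (fun x c => kind x = c) L (L.map kind) := by
      rw [List.forall₂_map_right_iff]
      exact List.forall₂_same.2 fun _ _ => rfl
    have h2 : Relation.Comp (List.Forall₂ fun x c => kind x = c) List.Perm L (L'.map kind) :=
      ⟨_, h1, hperm⟩
    rw [List.forall₂_comp_perm_eq_perm_comp_forall₂] at h2
    obtain ⟨L₁, h3, h4⟩ := h2
    exact ⟨L₁, h3, List.forall₂_map_right_iff.1 h4⟩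
  obtain ⟨e1⟩ := nonempty_homeomorph_walk_perm (by omega) ha h1 hL h0 hlen
  have hL₁ : ∀ x ∈ L₁, IsLetter x := fun x hx => hL x (h1.mem_iff.2 hx)
  have h3 : List.Forall₂ (fun x y => x.1 = y.1 ∧ x.2 0 = y.2 0 ∧ x.2 2 = y.2 2) L₁ L' := by
    rw [List.forall₂_iff_get] at h2 ⊢
    refine ⟨h2.1, fun i hi hi' => ?_⟩
    have e := Prod.ext_iff.1 (h2.2 i hi hi')
    exact ⟨e.1, e.2, by rw [(hL₁ _ (List.get_mem _ _)).1, (hL' _ (List.get_mem _ _)).1]⟩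
  have h4 := fun i : ZMod m => walk_getD_of_forall₂ h3 a a rfl rfl i.val
  obtain ⟨e2⟩ := nonempty_homeomorph_of_eq_mod (by omega : 0 < m)
    (colorAdj_walk hm hL₁ (((h1.map _).sum_eq).symm.trans h0) a ha
      (by rw [← h1.length_eq, ← h1.countP_eq, hlen]))
    (colorAdj_walk hm hL' h0' a ha hlen') (fun i => (h4 i).1.symm) (fun i => (h4 i).2.symm)
  exact ⟨e1.trans e2⟩

end Moves

/-! ### From colorings to closed walks, and the invariants of a walk -/

/-- Reading off the letters of a walk. -/
theorem exists_walk_eq (m : ℕ) (f : ℕ → (Fin 3 → ZMod 2)) (hf : ∀ j, ColorAdj (f j) (f (j + 1)))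
    (h0 : f 0 2 = 1) (hm : f m 2 = 1) :
    ∃ L, (∀ x ∈ L, IsLetter x) ∧ walk (f 0) L = (List.range m).map f ∧
      f 0 + walkTotal L = f m ∧
      L.countP Prod.fst = ∑ j ∈ Finset.range m, (if f (j + 1) = colorD then 1 else 0) ∧
      L.countP (fun x => x.2 0 = 1) = ∑ j ∈ Finset.range m,
        (if f (j + 1) = colorD ∧ f j 0 ≠ f (j + 2) 0 then 1 else 0) := by
  induction m using Nat.strong_induction_on generalizing f with
  | _ m ih =>
  have hne : ∀ j, f j 2 = 1 → f j ≠ colorD := by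
    intro j hj h
    rw [h] at hj; exact absurd hj (by decide)
  rcases m with _ | m
  · exact ⟨[], by simp, rfl, by simp [walkTotal], rfl, rfl⟩
  have h1 := (hf 0).eq_add h0
  by_cases hgap : f 1 2 = 1
  · obtain ⟨L, e1, e2, e3, e4, e5⟩ := ih m (by omega) (fun j => f (j + 1)) (fun j => hf (j + 1))
      hgap hm
    rw [zero_add] at e2 e3
    refine ⟨(false, colorD) :: L, ?_, ?_, ?_, ?_, ?_⟩
    · rw [List.forall_mem_cons]
      exact ⟨⟨rfl, fun _ => rfl⟩, e1⟩
    · rw [List.range_succ_eq_map, List.map_cons, List.map_map]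
      simp only [walk, ← h1 hgap, e2]
      rfl
    · rw [walkTotal_cons, ← add_assoc, ← h1 hgap, e3]
    · rw [Finset.sum_range_succ', if_neg (hne _ hgap), ← e4]
      simp
    · rw [Finset.sum_range_succ', if_neg (fun h => hne _ hgap h.1), ← e5]
      simp [colorD]
  -- A letter crossing a D uses up two faces, hence the strong induction.
  · have hd : f 1 = colorD := (hf 1).eq_or_left.resolve_right hgap
    rcases m with _ | m
    · exact absurd hm hgap
    have h2 : f 2 2 = 1 := by
      rcases hf 1 with h | h | h
      · exact h.2
      · exact absurd h.1 hgap
      · exact absurd h.1 hgap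
    obtain ⟨L, e1, e2, e3, e4, e5⟩ := ih m (by omega) (fun j => f (j + 2)) (fun j => hf (j + 2))
      h2 hm
    rw [zero_add] at e2 e3
    have hs : f 0 + (f 2 + f 0) = f 2 := by
      rw [add_comm, SmallCover.add_add_cancel_two]
    refine ⟨(true, f 2 + f 0) :: L, ?_, ?_, ?_, ?_, ?_⟩
    · rw [List.forall_mem_cons]
      refine ⟨⟨?_, fun h => absurd h (by simp)⟩, e1⟩
      change f 2 2 + f 0 2 = 0
      rw [h0, h2]; rfl
    · rw [List.range_succ_eq_map, List.range_succ_eq_map]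
      simp only [walk, hs, e2, List.map_cons, List.map_map, if_true, hd]
      rfl
    · rw [walkTotal_cons, ← add_assoc, hs, e3]
    · rw [Finset.sum_range_succ', Finset.sum_range_succ', zero_add, if_pos hd,
        if_neg (hne _ h2), List.countP_cons, e4]
      rfl
    · rw [Finset.sum_range_succ', Finset.sum_range_succ', zero_add,
        if_neg (fun h => hne _ h2 h.1), List.countP_cons, e5]
      have hiff : f 2 0 + f 0 0 = 1 ↔ ¬ f 0 0 = f 2 0 := by
        generalize f 2 0 = s; generalize f 0 0 = t
        revert s t; decide
      simp [hiff, hd]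

theorem ncard_zmod_eq_sum {m : ℕ} (hm : 0 < m) (p : ZMod m → Prop) [DecidablePred p] (r : ZMod m) :
    {i | p i}.ncard = ∑ j ∈ Finset.range m, (if p (r + (j : ZMod m)) then 1 else 0) := by
  have : NeZero m := ⟨hm.ne'⟩
  rw [Set.ncard_eq_toFinset_card', Set.toFinset_ofPred, Finset.card_filter]
  refine Finset.sum_nbij' (fun i => (i - r).val) (fun j => r + (j : ZMod m)) ?_ ?_ ?_ ?_ ?_
  · exact fun i _ => Finset.mem_range.2 (ZMod.val_lt _)
  · exact fun j _ => Finset.mem_univ _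
  · intro i _; simp
  · intro j hj
    rw [add_sub_cancel_left, ZMod.val_natCast_of_lt (Finset.mem_range.1 hj)]
  · intro i _; simp

/-- If q is a gap color, its neighbors are D or q + D, so all three colors lie in the plane spanned
by q and D. If q = D, then p and r are gap colors, and p + r lies in {0, D} exactly when their first
coordinates agree. -/
theorem colorAdj_span_iff {p q r : Fin 3 → ZMod 2} (h1 : ColorAdj p q) (h2 : ColorAdj q r) :
    Submodule.span (ZMod 2) {p, q, r} = ⊤ ↔ q = colorD ∧ p 0 ≠ r 0 := by
  have hvanish : ∀ k : ZMod 2, sheetForm k p = 0 → sheetForm k q = 0 → sheetForm k r = 0 →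
      Submodule.span (ZMod 2) {p, q, r} ≠ ⊤ := by
    intro k hp hq hr h
    let φ : (Fin 3 → ZMod 2) →ₗ[ZMod 2] ZMod 2 := LinearMap.proj 0 + k • LinearMap.proj 2
    have hle : Submodule.span (ZMod 2) {p, q, r} ≤ LinearMap.ker φ := by
      rw [Submodule.span_le]
      rintro v (rfl | rfl | rfl)
      · exact hp
      · exact hq
      · exact hr
    rw [h] at hle
    have : φ ![1, 0, 0] = 0 := hle Submodule.mem_top
    change (1 : ZMod 2) + k * 0 = 0 at this
    simp at this
  have hd : ∀ k, sheetForm k colorD = 0 := by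
    intro k
    change (0 : ZMod 2) + k * 0 = 0
    simp
  have hgap : ∀ v : Fin 3 → ZMod 2, v 2 = 1 → sheetForm (v 0) v = 0 := by
    intro v hv
    change v 0 + v 0 * v 2 = 0
    rw [hv, mul_one]; exact CharTwo.add_self_eq_zero _
  constructor
  · intro h
    by_cases hq : q = colorD
    · refine ⟨hq, fun hpr => ?_⟩
      have hp : p 2 = 1 := by
        rcases h1 with h1 | h1 | h1
        · rw [h1.1, hq] at *; exact absurd h1.2 (by decide)
        · exact h1.1
        · exact h1.1
      have hr : r 2 = 1 := by
        rcases h2 with h2 | h2 | h2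
        · exact h2.2
        · rw [hq] at h2; exact absurd h2.1 (by decide)
        · rw [hq] at h2; exact absurd h2.1 (by decide)
      exact hvanish (p 0) (hgap p hp) (by rw [hq, hd]) (by rw [hpr]; exact hgap r hr) h
    · have hq2 := h2.eq_or_left.resolve_left hq
      refine absurd h (hvanish (q 0) ?_ (hgap q hq2) ?_)
      · rcases h1 with h1 | h1 | h1
        · rw [h1.1, hd]
        · exact absurd h1.2 hq
        · have := hgap q hq2
          rw [h1.2, map_add, hd, add_zero] at this
          rw [h1.2]; exact this
      · rcases h2 with h2 | h2 | h2
        · exact absurd h2.1 hq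
        · rw [h2.2, hd]
        · rw [h2.2, map_add, hd, hgap q hq2, add_zero]
  · rintro ⟨rfl, hpr⟩
    have hp : p 2 = 1 := by
      rcases h1 with h1 | h1 | h1
      · exact absurd h1.2 (by decide)
      · exact h1.1
      · exact h1.1
    have hr : r 2 = 1 := by
      rcases h2 with h2 | h2 | h2
      · exact h2.2
      · exact absurd h2.1 (by decide)
      · exact absurd h2.1 (by decide)
    rw [Submodule.eq_top_iff']
    intro v
    have key : ∀ s t : ZMod 2, s ≠ t → s + t = 1 := by decide
    have hs := key _ _ hpr
    have h2 : (2 : ZMod 2) = 0 := rfl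
    -- The coefficients of p and r are determined by coordinates 0 and 2, using p 0 + r 0 = 1 and p
    -- 2 = r 2 = 1; that of D then corrects coordinate 1.
    have e : v = (v 2 + v 0 + v 2 * p 0) • p + (v 0 + v 2 * p 0) • r +
        (v 1 + (v 2 + v 0 + v 2 * p 0) * p 1 + (v 0 + v 2 * p 0) * r 1) • colorD := by
      have hr0 : r 0 = 1 + p 0 := by linear_combination hs - p 0 * h2
      ext j
      fin_cases j
      · simp [colorD, hr0]
        linear_combination (-(v 0 * p 0) - v 2 * p 0 ^ 2 - v 2 * p 0) * h2
      · simp [colorD]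
        linear_combination (-(v 2 + v 0 + v 2 * p 0) * p 1 - (v 0 + v 2 * p 0) * r 1) * h2
      · simp [colorD, hp, hr]
        linear_combination (-(v 0) - v 2 * p 0) * h2
    rw [e]
    exact Submodule.add_mem _ (Submodule.add_mem _
      (Submodule.smul_mem _ _ (Submodule.subset_span (by simp)))
      (Submodule.smul_mem _ _ (Submodule.subset_span (by simp))))
      (Submodule.smul_mem _ _ (Submodule.subset_span (by simp)))

/-! ### Normalizing a coloring -/

/-- A color that is neither zero nor the color of the ceiling nor that of the floor. -/
def IsSideColor (c f v : Fin 3 → ZMod 2) : Prop := v ≠ 0 ∧ v ≠ c ∧ v ≠ f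

theorem IsSideColor.eq_colorD {v : Fin 3 → ZMod 2} (h : IsSideColor ![1, 0, 0] ![1, 1, 0] v)
    (hv : v 2 = 0) : v = colorD := by
  obtain ⟨h1, h2, h3⟩ := h
  have key : ∀ x : ZMod 2, x = 0 ∨ x = 1 := by decide
  rcases key (v 0) with e0 | e0 <;> rcases key (v 1) with e1 | e1
  · exact absurd (by ext j; fin_cases j <;> assumption) h1
  · ext j; fin_cases j <;> assumption
  · exact absurd (by ext j; fin_cases j <;> assumption) h2
  · exact absurd (by ext j; fin_cases j <;> assumption) h3

/-- Independence constrains p + q as well: two D's would sum to zero, and two gap colors have a sum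
with third coordinate 0, which must be D. -/
theorem colorAdj_of_isSideColor {p q : Fin 3 → ZMod 2}
    (hp : IsSideColor ![1, 0, 0] ![1, 1, 0] p) (hq : IsSideColor ![1, 0, 0] ![1, 1, 0] q)
    (hpq : IsSideColor ![1, 0, 0] ![1, 1, 0] (p + q)) : ColorAdj p q := by
  have key : ∀ x : ZMod 2, x = 0 ∨ x = 1 := by decide
  rcases key (p 2) with ep | ep <;> rcases key (q 2) with eq | eq
  · refine absurd ?_ hpq.1
    rw [hp.eq_colorD ep, hq.eq_colorD eq]; decide
  · exact Or.inl ⟨hp.eq_colorD ep, eq⟩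
  · exact Or.inr (Or.inl ⟨ep, hq.eq_colorD eq⟩)
  · refine Or.inr (Or.inr ⟨ep, ?_⟩)
    rw [← hpq.eq_colorD (by rw [Pi.add_apply, ep, eq]; rfl), add_comm p q, add_comm,
      SmallCover.add_add_cancel_two]

theorem ne_of_linearIndependent {c p q : Fin 3 → ZMod 2}
    (h : LinearIndependent (ZMod 2) ![c, p, q]) :
    c ≠ 0 ∧ (p ≠ 0 ∧ p ≠ c) ∧ (q ≠ 0 ∧ q ≠ c) ∧ (p + q ≠ 0 ∧ p + q ≠ c) := by
  rw [Fintype.linearIndependent_iff] at h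
  have key : ∀ x y z : ZMod 2, x • c + y • p + z • q = 0 → x = 0 ∧ y = 0 ∧ z = 0 := by
    intro x y z hxyz
    have := h ![x, y, z] (by simpa [Fin.sum_univ_three] using hxyz)
    exact ⟨this 0, this 1, this 2⟩
  have h2 : ∀ v : Fin 3 → ZMod 2, v + v = 0 := by
    intro v
    simpa using SmallCover.add_add_cancel_two 0 v
  refine ⟨?_, ⟨?_, ?_⟩, ⟨?_, ?_⟩, ?_, ?_⟩ <;> intro e
  · exact absurd (key 1 0 0 (by simp [e])).1 one_ne_zero
  · exact absurd (key 0 1 0 (by simp [e])).2.1 one_ne_zero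
  · exact absurd (key 1 1 0 (by simp [e, h2])).1 one_ne_zero
  · exact absurd (key 0 0 1 (by simp [e])).2.2 one_ne_zero
  · exact absurd (key 1 0 1 (by simp [e, h2])).1 one_ne_zero
  · exact absurd (key 0 1 1 (by simp [e])).2.1 one_ne_zero
  · exact absurd (key 1 1 1 (by simp [add_assoc, e, h2])).1 one_ne_zero

/-- Moving a basis of `ℤ₂³` to standard position. -/
theorem exists_linearEquiv {c f g : Fin 3 → ZMod 2} (hc : c ≠ 0) (hf : f ≠ 0) (hcf : c ≠ f)
    (hg : IsSideColor c f g) (hg' : g ≠ c + f) :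
    ∃ A : (Fin 3 → ZMod 2) ≃ₗ[ZMod 2] (Fin 3 → ZMod 2),
      A c = ![1, 0, 0] ∧ A f = ![1, 1, 0] ∧ A g = ![0, 0, 1] := by
  have cancel : ∀ v w : Fin 3 → ZMod 2, v + w = 0 → v = w := by
    intro v w h
    rw [← SmallCover.add_add_cancel_two v w, h, zero_add]
  have hli : LinearIndependent (ZMod 2) ![c, c + f, g] := by
    rw [Fintype.linearIndependent_iff]
    intro x hx
    simp only [Fin.sum_univ_three, Matrix.cons_val_zero, Matrix.cons_val_one, Matrix.cons_val] at hx
    have key : ∀ x : ZMod 2, x = 0 ∨ x = 1 := by decide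
    have hccf : c + (c + f) = f := by
      rw [add_comm c f, add_comm, SmallCover.add_add_cancel_two]
    rcases key (x 0) with e0 | e0 <;> rcases key (x 1) with e1 | e1 <;>
      rcases key (x 2) with e2 | e2 <;>
      simp only [e0, e1, e2, zero_smul, one_smul, zero_add, add_zero, hccf] at hx
    · intro i; fin_cases i <;> assumption
    · exact absurd hx hg.1
    · exact absurd (cancel _ _ hx) hcf
    · exact absurd (cancel _ _ hx).symm hg'
    · exact absurd hx hc
    · exact absurd (cancel _ _ hx).symm hg.2.1
    · exact absurd hx hf
    · exact absurd (cancel _ _ hx).symm hg.2.2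
  let b := basisOfLinearIndependentOfCardEqFinrank hli (by simp)
  have hb : ⇑b = ![c, c + f, g] := coe_basisOfLinearIndependentOfCardEqFinrank _ _
  have h0 : b.equivFun c = ![1, 0, 0] := by
    have : c = b 0 := by rw [hb]; rfl
    ext j
    rw [this, b.equivFun_self]
    fin_cases j <;> rfl
  have h1 : b.equivFun (c + f) = ![0, 1, 0] := by
    have : c + f = b 1 := by rw [hb]; rfl
    ext j
    rw [this, b.equivFun_self]
    fin_cases j <;> rfl
  have h2 : b.equivFun g = ![0, 0, 1] := by
    have : g = b 2 := by rw [hb]; rfl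
    ext j
    rw [this, b.equivFun_self]
    fin_cases j <;> rfl
  refine ⟨b.equivFun, h0, ?_, h2⟩
  have : f = c + (c + f) := by
    rw [add_comm c f, add_comm, SmallCover.add_add_cancel_two]
  rw [this, map_add, h0, h1]; decide

theorem PrismFacet.side_injective (m : ℕ) : Function.Injective (PrismFacet.side (m := m)) :=
  fun _ _ h => by injection h

/-- Three facets of the prism meeting at a vertex. -/
theorem IsPrismColoring.linearIndependent {m : ℕ} (hm : 1 < m)
    {lam : PrismFacet m → (Fin 3 → ZMod 2)} (h : IsPrismColoring lam) (i : ZMod m)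
    (F : PrismFacet m) (hF : F = .ceiling ∨ F = .floor) :
    LinearIndependent (ZMod 2) ![lam F, lam (.side i), lam (.side (i + 1))] := by
  classical
  have : Fact (1 < m) := ⟨hm⟩
  have hm0 : 0 < m := by omega
  obtain ⟨a, rfl⟩ := ZMod.intCast_surjective i
  let t : Finset (PrismFacet m) := {F, .side (a : ZMod m), .side ((a : ZMod m) + 1)}
  have hv1 : circlePoint m (a + 1 : ℤ) ∈ polygonEdge m (a : ZMod m) := by
    rw [polygonEdge_intCast hm0]; exact right_mem_segment _ _ _
  have hv2 : circlePoint m (a + 1 : ℤ) ∈ polygonEdge m ((a : ZMod m) + 1) := by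
    have : ((a : ZMod m) + 1) = ((a + 1 : ℤ) : ZMod m) := by push_cast; rfl
    rw [this, polygonEdge_intCast hm0]; exact left_mem_segment _ _ _
  have hv := circlePoint_mem_polygon hm0 (a + 1)
  have hne : (prism m ∩ ⋂ G ∈ t, prismFacet m G).Nonempty := by
    rcases hF with rfl | rfl
    · refine ⟨(circlePoint m (a + 1 : ℤ), 1), ⟨hv, by simp⟩, Set.mem_iInter₂.2 fun G hG => ?_⟩
      simp only [t, Finset.mem_insert, Finset.mem_singleton] at hG
      rcases hG with rfl | rfl | rfl
      · exact ⟨hv, rfl⟩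
      · exact ⟨hv1, by simp⟩
      · exact ⟨hv2, by simp⟩
    · refine ⟨(circlePoint m (a + 1 : ℤ), 0), ⟨hv, by simp⟩, Set.mem_iInter₂.2 fun G hG => ?_⟩
      simp only [t, Finset.mem_insert, Finset.mem_singleton] at hG
      rcases hG with rfl | rfl | rfl
      · exact ⟨hv, rfl⟩
      · exact ⟨hv1, by simp⟩
      · exact ⟨hv2, by simp⟩
  have hli := h t hne
  -- The family over the finset is reindexed by `Fin 3`; for this the two side labels must differ,
  -- which uses 1 < m.
  let e : Fin 3 → t := ![⟨F, by simp [t]⟩, ⟨.side (a : ZMod m), by simp [t]⟩,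
    ⟨.side ((a : ZMod m) + 1), by simp [t]⟩]
  have he : Function.Injective e := by
    have h1 : ∀ j : ZMod m, F ≠ .side j := by
      rintro j rfl; rcases hF with h | h <;> cases h
    have h2 : (PrismFacet.side (a : ZMod m)) ≠ .side ((a : ZMod m) + 1) := by
      intro h
      simpa using PrismFacet.side_injective m h
    intro x y hxy
    fin_cases x <;> fin_cases y <;> simp [e, h1, h2, (h1 _).symm, h2.symm] at hxy ⊢
  convert hli.comp e he using 1
  ext x
  fin_cases x <;> rfl

/-- Every nontrivial coloring is equivalent to a closed walk with the same invariants. -/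
theorem exists_walk_of_isPrismColoring {m : ℕ} (hm : 1 < m)
    {lam : PrismFacet m → (Fin 3 → ZMod 2)} (h : IsPrismColoring lam)
    (hnt : IsNontrivialColoring lam) :
    ∃ L, (∀ x ∈ L, IsLetter x) ∧ walkTotal L = 0 ∧ L.length + L.countP Prod.fst = m ∧
      L.countP Prod.fst = nInv lam ∧ L.countP (fun x => x.2 0 = 1) = mInv lam ∧
      Nonempty (PrismSmallCover lam ≃ₜ PrismSmallCover (listColoring m (walk ![0, 0, 1] L))) := by
  have hm0 : 0 < m := by omega
  have : NeZero m := ⟨hm0.ne'⟩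
  have hc := fun i => ne_of_linearIndependent (h.linearIndependent hm i .ceiling (Or.inl rfl))
  have hf := fun i => ne_of_linearIndependent (h.linearIndependent hm i .floor (Or.inr rfl))
  have hside : ∀ i, IsSideColor (lam .ceiling) (lam .floor) (lam (.side i)) := fun i =>
    ⟨(hc i).2.1.1, (hc i).2.1.2, (hf i).2.1.2⟩
  -- Adjacent faces have different colors, so not all side faces are colored D; the walk starts at a
  -- face r with a gap color.
  obtain ⟨r, hr⟩ : ∃ r, lam (.side r) ≠ lam .ceiling + lam .floor := by
    by_contra! hall
    refine (hc 0).2.2.2.1 ?_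
    rw [hall, hall]
    simpa using SmallCover.add_add_cancel_two 0 (lam .ceiling + lam .floor)
  obtain ⟨A, hA1, hA2, hA3⟩ := exists_linearEquiv (hc 0).1 (hf 0).1 hnt (hside r) hr
  have hA : ∀ v, IsSideColor (lam .ceiling) (lam .floor) v →
      IsSideColor ![1, 0, 0] ![1, 1, 0] (A v) := by
    rintro v ⟨h1, h2, h3⟩
    refine ⟨by simpa using h1, ?_, ?_⟩
    · rw [← hA1]; exact A.injective.ne h2
    · rw [← hA2]; exact A.injective.ne h3
  have hadj : ∀ i, ColorAdj (A (lam (.side i))) (A (lam (.side (i + 1)))) := fun i =>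
    colorAdj_of_isSideColor (hA _ (hside i)) (hA _ (hside _))
      (by rw [← map_add]; exact hA _ ⟨(hc i).2.2.2.1, (hc i).2.2.2.2, (hf i).2.2.2.2⟩)
  -- The normalized side colors, unrolled from face r; they close up after m steps.
  let f : ℕ → (Fin 3 → ZMod 2) := fun j => A (lam (.side (r + (j : ZMod m))))
  have hf0 : f 0 = ![0, 0, 1] := by simp [f, hA3]
  have hfm : f m = ![0, 0, 1] := by simp [f, hA3]
  have hfadj : ∀ j, ColorAdj (f j) (f (j + 1)) := by
    intro j
    have := hadj (r + j)
    simp only [f]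
    rwa [Nat.cast_succ, ← add_assoc]
  obtain ⟨L, h1, h2, h3, h4, h5⟩ := exists_walk_eq m f hfadj (by rw [hf0]; rfl) (by rw [hfm]; rfl)
  have hAD : A (lam .ceiling - lam .floor) = colorD := by
    rw [map_sub, hA1, hA2]; decide
  refine ⟨L, h1, ?_, ?_, ?_, ?_, ?_⟩
  · rwa [hf0, hfm, add_eq_left] at h3
  · rw [← length_walk L (f 0), h2]; simp
  · classical
    -- The sums test the face at j + 1, the middle one of j, j + 1, j + 2; so the count starts at r
    -- + 1.
    rw [h4, nInv, ncard_zmod_eq_sum hm0 _ (r + 1)]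
    refine Finset.sum_congr rfl fun j _ => if_congr ?_ rfl rfl
    rw [← hAD, A.injective.eq_iff, Nat.cast_succ, add_right_comm, add_assoc]
  · classical
    rw [h5, mInv, ncard_zmod_eq_sum hm0 _ (r + 1)]
    refine Finset.sum_congr rfl fun j _ => if_congr ?_ rfl rfl
    rw [← colorAdj_span_iff (hfadj j) (hfadj (j + 1))]
    have e1 : r + 1 + (j : ZMod m) - 1 = r + (j : ZMod m) := by ring
    have e2 : r + 1 + (j : ZMod m) = r + ((j + 1 : ℕ) : ZMod m) := by push_cast; ring
    have e3 : r + 1 + (j : ZMod m) + 1 = r + ((j + 1 + 1 : ℕ) : ZMod m) := by push_cast; ring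
    rw [e3, e1, e2]
    -- An automorphism preserves whether three colors span.
    refine Iff.trans ?_ (Submodule.map_eq_top_iff (e := A))
    rw [Submodule.map_span, Set.image_insert_eq, Set.image_insert_eq, Set.image_singleton]
    rfl
  -- Rotating by -r makes r the face with index 0.
  · obtain ⟨a, ha⟩ := ZMod.intCast_surjective (-r)
    refine nonempty_homeomorph_of_rotation hm0 a A hA1.symm hA2.symm fun i => ?_
    obtain ⟨j, hj, rfl⟩ : ∃ j < m, r + ((j : ℕ) : ZMod m) = i :=
      ⟨(i - r).val, ZMod.val_lt _, by simp⟩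
    rw [ha, show r + (j : ZMod m) + -r = (j : ZMod m) by ring, listColoring_side _ hj, ← hf0, h2]
    simp [List.getD_eq_getElem?_getD, hj, f]

theorem corollary5 (m : ℕ) (hm : 3 < m)
    (lam₁ lam₂ : PrismFacet m → (Fin 3 → ZMod 2))
    (hlam₁ : IsPrismColoring lam₁) (hlam₂ : IsPrismColoring lam₂)
    (hnt₁ : IsNontrivialColoring lam₁) (hnt₂ : IsNontrivialColoring lam₂)
    (h : (mInv lam₁, nInv lam₁) = (mInv lam₂, nInv lam₂)) :
    Nonempty (PrismSmallCover lam₁ ≃ₜ PrismSmallCover lam₂) := by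
  obtain ⟨L₁, a1, a2, a3, a4, a5, ⟨e1⟩⟩ := exists_walk_of_isPrismColoring (by omega) hlam₁ hnt₁
  obtain ⟨L₂, b1, b2, b3, b4, b5, ⟨e2⟩⟩ := exists_walk_of_isPrismColoring (by omega) hlam₂ hnt₂
  obtain ⟨h1, h2⟩ := Prod.ext_iff.1 h
  obtain ⟨e⟩ := nonempty_homeomorph_walk (a := ![0, 0, 1]) (by omega : 1 < m) rfl a1 b1 a2 b2 a3 b3
    (by rw [a4, b4]; exact h2) (by rw [a5, b5]; exact h1)
  exact ⟨(e1.trans e).trans e2.symm⟩
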